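/- Let $m_k(x)=\sqrt{2/\pi}\,\sin(kx)$ for $k\ge 1$, and let $P^D(t,x,y)=\sum_{k=1}^{\infty}e^{-k^2t}m_k(x)m_k(y)$ be the Dirichlet heat kernel on $(0,\pi)$. For a function $f$ on $(0,T)\times(0,\pi)$ put $$(P^D\star f)(t,x)=\int_0^t\int_0^\pi P^D(t-s,x,y)\,f(s,y)\,dy\,ds .$$ Let $1\le p<\infty$, let $e^{t\Delta}h=\int_0^\pi P^D(t,\cdot,y)h(y)\,dy$ be the heat semigroup on $L_p(0,\pi)$ with zero boundary conditions, and let $\Delta$ be its generator. For $0<s<2$ put $$(-\Delta)^{s/2}f=\frac1{\Gamma(-s/2)}\int_0^\infty(e^{t\Delta}-I)f\,\frac{dt}{t^{1+s/2}},$$ where the integral is the limit in $L_p(0,\pi)$ of $\int_\varepsilon^\infty$ as $\varepsilon\to0^+$; for $2<s<4$ put $(-\Delta)^{s/2}=(-\Delta)^{(s-2)/2}(-\Delta)$. Let $H^s_p(0,\pi)$ be the space of all $f\in L_p(0,\pi)$ for which $(-\Delta)^{s/2}f$ exists in $L_p(0,\pi)$, with the norm $\|f\|_{H^s_p}=\|(-\Delta)^{s/2}f\|_{L_p(0,\pi)}$.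 **Theorem.** Let $0<\beta<\gamma<1$. There is a constant $C>0$, depending only on $\beta$ and $\gamma$, such that for all $1\le p<\infty$ and all $T>0$ the following holds. For every $f\in L_\infty(0,T;H^\gamma_p(0,\pi))$, the integral in $s$ that defines $(P^D\star f)(t,x)$ converges absolutely for all $t\in(0,T)$ and $x\in(0,\pi)$. The mapping $f\mapsto P^D\star f$ is a continuous linear map from $L_\infty(0,T;H^\gamma_p(0,\pi))$ to $L_\infty(0,T;H^{2+\beta}_p(0,\pi))$, and $$\|P^D\star f\|_{L_\infty(0,T;H^{2+\beta}_p(0,\pi))}\le C\,T^{(\gamma-\beta)/2}\,\|f\|_{L_\infty(0,T;H^{\gamma}_p(0,\pi))}.$$ -/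

import Mathlib

open MeasureTheory Set Filter Topology
open scoped ENNReal

noncomputable section

namespace DirichletHeat

/-- Lebesgue measure on the interval `(0, π)`. -/
abbrev intervalMeasure : Measure ℝ := volume.restrict (Ioo 0 Real.pi)

/-- The Lebesgue space `L_p(0, π)` of real-valued functions. -/
abbrev LpI (p : ℝ≥0∞) : Type := Lp ℝ p intervalMeasure

/-- The Dirichlet eigenfunction `m_k(x) = √(2/π) sin (k x)`. -/
def sineMode (k : ℕ) (x : ℝ) : ℝ := √(2 / Real.pi) * Real.sin (k * x)

/-- The Dirichlet heat kernel on `(0, π)`,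
`P^D(t,x,y) = ∑_{k ≥ 1} exp (-k² t) m_k(x) m_k(y)` (the summation index is shifted by one). -/
def heatKernel (t x y : ℝ) : ℝ :=
  ∑' k : ℕ, Real.exp (-((k + 1 : ℕ) : ℝ) ^ 2 * t) * sineMode (k + 1) x * sineMode (k + 1) y

/-- The space-time convolution
`(P^D ⋆ f)(t,x) = ∫_0^t ∫_0^π P^D(t-s,x,y) f(s,y) dy ds`. -/
def heatConv (f : ℝ → ℝ → ℝ) (t x : ℝ) : ℝ :=
  ∫ s in (0 : ℝ)..t, ∫ y in (0 : ℝ)..Real.pi, heatKernel (t - s) x y * f s y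

/-- The function `x ↦ ∫_0^π P^D(t,x,y) h(y) dy`. -/
def heatFun (t : ℝ) (h : ℝ → ℝ) (x : ℝ) : ℝ :=
  ∫ y in (0 : ℝ)..Real.pi, heatKernel t x y * h y

/-! ### Elementary facts on the heat kernel, needed for the definitions below -/

/-- The sine coefficient `∫_0^π m_{k+1}(y) h(y) dy`. -/
def sineCoeff (k : ℕ) (h : ℝ → ℝ) : ℝ := ∫ y, sineMode (k + 1) y * h y ∂intervalMeasure

lemma continuous_sineMode (k : ℕ) : Continuous (sineMode k) := by
  unfold sineMode; fun_prop

lemma abs_sineMode_le (k : ℕ) (x : ℝ) : |sineMode k x| ≤ √(2 / Real.pi) := by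
  unfold sineMode
  rw [abs_mul, abs_of_nonneg (Real.sqrt_nonneg _)]
  exact mul_le_of_le_one_right (Real.sqrt_nonneg _) (Real.abs_sin_le_one _)

lemma summable_exp {t : ℝ} (ht : 0 < t) :
    Summable fun k : ℕ => Real.exp (-((k + 1 : ℕ) : ℝ) ^ 2 * t) := by
  have h : Summable fun k : ℕ => Real.exp (k * (-t)) :=
    Real.summable_exp_nat_mul_iff.2 (by linarith)
  refine Summable.of_nonneg_of_le (fun k => (Real.exp_pos _).le) (fun k => ?_) h
  apply Real.exp_le_exp.2
  push_cast
  nlinarith [mul_nonneg (Nat.cast_nonneg (α := ℝ) k) ht.le,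
    mul_nonneg (mul_nonneg (Nat.cast_nonneg (α := ℝ) k) (Nat.cast_nonneg (α := ℝ) k)) ht.le]

lemma integrable_sineMode_mul (k : ℕ) {h : ℝ → ℝ} (hh : Integrable h intervalMeasure) :
    Integrable (fun y => sineMode k y * h y) intervalMeasure :=
  hh.bdd_mul (continuous_sineMode k).aestronglyMeasurable
    (Eventually.of_forall fun x => abs_sineMode_le k x)

lemma abs_sineCoeff_le (k : ℕ) {h : ℝ → ℝ} (hh : Integrable h intervalMeasure) :
    |sineCoeff k h| ≤ √(2 / Real.pi) * ∫ y, |h y| ∂intervalMeasure := by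
  unfold sineCoeff
  rw [← integral_const_mul]
  refine (abs_integral_le_integral_abs).trans (integral_mono ?_ ?_ fun y => ?_)
  · exact (integrable_sineMode_mul _ hh).abs
  · exact hh.abs.const_mul _
  · simp only [abs_mul]
    exact mul_le_mul_of_nonneg_right (abs_sineMode_le _ _) (abs_nonneg _)

/-- Sine expansion of `∫_0^π P^D(t,x,y) h(y) dy`. -/
lemma hasSum_heatFun {t : ℝ} (ht : 0 < t) {h : ℝ → ℝ} (hh : Integrable h intervalMeasure)
    (x : ℝ) :
    HasSum (fun k : ℕ => Real.exp (-((k + 1 : ℕ) : ℝ) ^ 2 * t) *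
      (sineCoeff k h * sineMode (k + 1) x)) (heatFun t h x) := by
  set a : ℕ → ℝ := fun k => Real.exp (-((k + 1 : ℕ) : ℝ) ^ 2 * t) with ha
  have ha0 : ∀ k, 0 ≤ a k := fun k => (Real.exp_pos _).le
  set D := √(2 / Real.pi) with hD
  have hD0 : 0 ≤ D := Real.sqrt_nonneg _
  have hint : ∀ k, Integrable
      (fun y => a k * sineMode (k + 1) x * (sineMode (k + 1) y * h y)) intervalMeasure :=
    fun k => (integrable_sineMode_mul _ hh).const_mul _
  have key := hasSum_integral_of_summable_integral_norm (μ := intervalMeasure)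
    (F := fun k y => a k * sineMode (k + 1) x * (sineMode (k + 1) y * h y)) hint ?_
  · have h1 : heatFun t h x = ∫ y, ∑' k, a k * sineMode (k + 1) x * (sineMode (k + 1) y * h y)
        ∂intervalMeasure := by
      unfold heatFun
      rw [intervalIntegral.integral_of_le Real.pi_pos.le, integral_Ioc_eq_integral_Ioo]
      refine integral_congr_ae (Eventually.of_forall fun y => ?_)
      simp only [heatKernel]
      rw [← tsum_mul_right]
      exact tsum_congr fun k => by simp only [ha]; ring
    rw [h1]
    refine (congrArg (fun F : ℕ → ℝ => HasSum F _) (funext fun k => ?_)).mpr key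
    rw [integral_const_mul]
    unfold sineCoeff
    ring
  · refine Summable.of_nonneg_of_le (fun k => integral_nonneg fun y => norm_nonneg _)
      (fun k => ?_) ((summable_exp ht).mul_right (D * (D * ∫ y, |h y| ∂intervalMeasure)))
    rw [← integral_const_mul, ← integral_const_mul, ← integral_const_mul]
    refine integral_mono (hint k).norm (((hh.abs.const_mul _).const_mul _).const_mul _)
      fun y => ?_
    simp only [Real.norm_eq_abs, abs_mul, abs_of_nonneg (ha0 k), mul_assoc]
    have e1 := abs_sineMode_le (k + 1) x
    have e2 := abs_sineMode_le (k + 1) y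
    show a k * _ ≤ a k * _
    gcongr

lemma abs_heatFun_term_le (k : ℕ) {h : ℝ → ℝ} (hh : Integrable h intervalMeasure) (x : ℝ) :
    |sineCoeff k h * sineMode (k + 1) x| ≤
      (√(2 / Real.pi) * ∫ y, |h y| ∂intervalMeasure) * √(2 / Real.pi) := by
  rw [abs_mul]
  exact mul_le_mul (abs_sineCoeff_le k hh) (abs_sineMode_le _ _) (abs_nonneg _)
    (mul_nonneg (Real.sqrt_nonneg _) (integral_nonneg fun _ => abs_nonneg _))

lemma continuous_heatFun {t : ℝ} (ht : 0 < t) {h : ℝ → ℝ} (hh : Integrable h intervalMeasure) :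
    Continuous (heatFun t h) := by
  have h1 : heatFun t h = fun x => ∑' k : ℕ, Real.exp (-((k + 1 : ℕ) : ℝ) ^ 2 * t) *
      (sineCoeff k h * sineMode (k + 1) x) :=
    funext fun x => (hasSum_heatFun ht hh x).tsum_eq.symm
  rw [h1]
  refine continuous_tsum (fun k => ?_) ((summable_exp ht).mul_right
    ((√(2 / Real.pi) * ∫ y, |h y| ∂intervalMeasure) * √(2 / Real.pi))) fun k x => ?_
  · exact continuous_const.mul (continuous_const.mul (continuous_sineMode _))
  · rw [norm_mul, Real.norm_of_nonneg (Real.exp_pos _).le, Real.norm_eq_abs]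
    exact mul_le_mul_of_nonneg_left (abs_heatFun_term_le k hh x) (Real.exp_pos _).le

lemma abs_heatFun_sub_le {t t' : ℝ} (ht : 0 < t) (ht' : 0 < t') {h : ℝ → ℝ}
    (hh : Integrable h intervalMeasure) (x : ℝ) :
    |heatFun t h x - heatFun t' h x| ≤
      (∑' k : ℕ, |Real.exp (-((k + 1 : ℕ) : ℝ) ^ 2 * t) -
        Real.exp (-((k + 1 : ℕ) : ℝ) ^ 2 * t')|) *
      ((√(2 / Real.pi) * ∫ y, |h y| ∂intervalMeasure) * √(2 / Real.pi)) := by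
  have hs := (hasSum_heatFun ht hh x).sub (hasSum_heatFun ht' hh x)
  have hsum := ((summable_exp ht).sub (summable_exp ht')).abs
  rw [← tsum_mul_right, ← Real.norm_eq_abs, ← hs.tsum_eq]
  refine tsum_of_norm_bounded (hsum.mul_right _).hasSum fun k => ?_
  rw [← sub_mul, norm_mul, Real.norm_eq_abs, Real.norm_eq_abs]
  exact mul_le_mul_of_nonneg_left (abs_heatFun_term_le k hh x) (abs_nonneg _)

lemma abs_heatFun_le {ε t : ℝ} (hε : 0 < ε) (ht : ε ≤ t) {h : ℝ → ℝ}
    (hh : Integrable h intervalMeasure) (x : ℝ) :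
    |heatFun t h x| ≤ (∑' k : ℕ, Real.exp (-((k + 1 : ℕ) : ℝ) ^ 2 * ε)) *
      ((√(2 / Real.pi) * ∫ y, |h y| ∂intervalMeasure) * √(2 / Real.pi)) := by
  have hs := hasSum_heatFun (hε.trans_le ht) hh x
  rw [← tsum_mul_right, ← Real.norm_eq_abs, ← hs.tsum_eq]
  refine tsum_of_norm_bounded ((summable_exp hε).mul_right _).hasSum fun k => ?_
  rw [norm_mul, Real.norm_of_nonneg (Real.exp_pos _).le, Real.norm_eq_abs]
  refine mul_le_mul (Real.exp_le_exp.2 ?_) (abs_heatFun_term_le k hh x) (abs_nonneg _)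
    (Real.exp_pos _).le
  nlinarith [sq_nonneg (((k + 1 : ℕ) : ℝ))]

lemma norm_le_of_bound {p : ℝ≥0∞} {f : LpI p} {C : ℝ} (hC : 0 ≤ C)
    (h : ∀ᵐ x ∂intervalMeasure, ‖(f : ℝ → ℝ) x‖ ≤ C) :
    ‖f‖ ≤ ((measureUnivNNReal intervalMeasure : ℝ) ^ p.toReal⁻¹) * C :=
  Lp.norm_le_of_ae_bound hC h

variable {p : ℝ≥0∞} [hp : Fact (1 ≤ p)]

lemma integrable_coe (f : LpI p) : Integrable f intervalMeasure :=
  (Lp.memLp f).integrable hp.out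

lemma memLp_heatFun {t : ℝ} (ht : 0 < t) (f : LpI p) :
    MemLp (heatFun t f) p intervalMeasure :=
  MemLp.of_bound (continuous_heatFun ht (integrable_coe f)).aestronglyMeasurable _
    (Eventually.of_forall fun x => abs_heatFun_le ht le_rfl (integrable_coe f) x)

/-- The heat semigroup `e^{tΔ}` on `L_p(0, π)` with zero boundary conditions:
`e^{tΔ} f = ∫_0^π P^D(t,·,y) f(y) dy` for `t > 0`, and `e^{0Δ} = I`
(the value for `t < 0` is irrelevant). -/
def heat (t : ℝ) (f : LpI p) : LpI p :=
  if ht : 0 < t then (memLp_heatFun ht f).toLp (heatFun t f) else f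

/-- `Δ f = g` in `L_p(0, π)`, where `Δ` is the Laplacian with zero boundary conditions, i.e. the
generator of the semigroup `e^{tΔ}`: `(e^{tΔ} f - f) / t → g` in `L_p(0, π)` as `t → 0+`. -/
def IsLaplacian (f g : LpI p) : Prop :=
  Tendsto (fun t : ℝ => t⁻¹ • (heat t f - f)) (𝓝[>] 0) (𝓝 g)

/-- `(-Δ)^n f = g` in `L_p(0, π)`, for a natural number `n`. -/
def IsNegLaplacianPow : ℕ → LpI p → LpI p → Prop
  | 0, f, g => g = f
  | n + 1, f, g => ∃ h, IsLaplacian f h ∧ IsNegLaplacianPow n (-h) g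

/-- `(-Δ)^{σ/2} f = g` in `L_p(0, π)` for `0 ≤ σ < 2`: for `0 < σ < 2`,
`g = Γ(-σ/2)⁻¹ ∫_0^∞ (e^{tΔ} - I) f dt / t^{1+σ/2}`, the integral being improper at `t = 0`
and convergent in `L_p(0, π)`; for `σ = 0`, `g = f`. -/
def IsFracLaplacianLow (σ : ℝ) (f g : LpI p) : Prop :=
  if 0 < σ then
    Tendsto (fun ε : ℝ => (Real.Gamma (-σ / 2))⁻¹ •
      ∫ t in Ioi ε, (t ^ (1 + σ / 2))⁻¹ • (heat t f - f)) (𝓝[>] 0) (𝓝 g)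
  else g = f

/-- `(-Δ)^{s/2} f = g` in `L_p(0, π)` for real `s ≥ 0`: write `s = 2 n + σ` with `n` a natural
number and `0 ≤ σ < 2`; then `(-Δ)^{s/2} = (-Δ)^{σ/2} (-Δ)^n`. -/
def IsFracLaplacian (s : ℝ) (f g : LpI p) : Prop :=
  ∃ h, IsNegLaplacianPow ⌊s / 2⌋₊ f h ∧ IsFracLaplacianLow (s - 2 * ⌊s / 2⌋₊) h g

/-! ### Linearity and injectivity of the fractional Laplacian -/

lemma coeFn_heat {t : ℝ} (ht : 0 < t) (f : LpI p) :
    (heat t f : ℝ → ℝ) =ᵐ[intervalMeasure] heatFun t f := by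
  rw [heat, dif_pos ht]
  exact MemLp.coeFn_toLp _

lemma sineCoeff_congr (k : ℕ) {f g : ℝ → ℝ} (h : f =ᵐ[intervalMeasure] g) :
    sineCoeff k f = sineCoeff k g :=
  integral_congr_ae (h.mono fun x hx => by simp only [hx])

/-- The sine coefficient as a continuous linear functional on `L_p(0, π)`. -/
def sineCoeffL (k : ℕ) : LpI p →L[ℝ] ℝ :=
  LinearMap.mkContinuousOfExistsBound
    { toFun := fun f => sineCoeff k f
      map_add' := fun f g => by
        rw [sineCoeff_congr k (Lp.coeFn_add f g)]
        unfold sineCoeff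
        rw [← integral_add (integrable_sineMode_mul _ (integrable_coe f))
          (integrable_sineMode_mul _ (integrable_coe g))]
        exact integral_congr_ae (Eventually.of_forall fun x => by simp [mul_add])
      map_smul' := fun c f => by
        rw [sineCoeff_congr k (Lp.coeFn_smul c f)]
        unfold sineCoeff
        simp only [Pi.smul_apply, smul_eq_mul, RingHom.id_apply]
        rw [← integral_const_mul]
        exact integral_congr_ae (Eventually.of_forall fun x => by
          simp only []; ring) } <| by
    refine ⟨√(2 / Real.pi) * (intervalMeasure univ ^
      (1 / (1 : ℝ≥0∞).toReal - 1 / p.toReal)).toReal, fun f => ?_⟩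
    refine (abs_sineCoeff_le k (integrable_coe f)).trans ?_
    rw [mul_assoc]
    refine mul_le_mul_of_nonneg_left ?_ (Real.sqrt_nonneg _)
    have h1 : ∫ y, |(f : ℝ → ℝ) y| ∂intervalMeasure
        = (eLpNorm f 1 intervalMeasure).toReal := by
      rw [eLpNorm_one_eq_lintegral_enorm]
      exact integral_norm_eq_lintegral_enorm (Lp.aestronglyMeasurable f)
    rw [h1, Lp.norm_def, mul_comm, ← ENNReal.toReal_mul]
    have hq : 0 ≤ 1 / (1 : ℝ≥0∞).toReal - 1 / p.toReal := by
      rcases eq_or_ne p ∞ with rfl | h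
      · simp
      · have : 1 ≤ p.toReal := by
          simpa using ENNReal.toReal_mono h hp.out
        rw [ENNReal.toReal_one, sub_nonneg, div_one]
        exact (div_le_one (by linarith)).2 this
    refine ENNReal.toReal_mono (ENNReal.mul_ne_top (Lp.eLpNorm_ne_top f) ?_)
      (eLpNorm_le_eLpNorm_mul_rpow_measure_univ hp.out (Lp.aestronglyMeasurable f))
    exact ENNReal.rpow_ne_top_of_nonneg hq (measure_ne_top _ _)

lemma sineCoeffL_apply (k : ℕ) (f : LpI p) : sineCoeffL k f = sineCoeff k f := rfl

lemma heatFun_congr (t x : ℝ) {f g : ℝ → ℝ} (h : f =ᵐ[intervalMeasure] g) :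
    heatFun t f x = heatFun t g x := by
  unfold heatFun
  rw [intervalIntegral.integral_of_le Real.pi_pos.le, integral_Ioc_eq_integral_Ioo,
    intervalIntegral.integral_of_le Real.pi_pos.le, integral_Ioc_eq_integral_Ioo]
  exact integral_congr_ae (h.mono fun x hx => by simp only [hx])

lemma heat_add (t : ℝ) (f g : LpI p) : heat t (f + g) = heat t f + heat t g := by
  by_cases ht : 0 < t
  · apply Lp.ext
    filter_upwards [coeFn_heat ht (f + g), coeFn_heat ht f, coeFn_heat ht g,
      Lp.coeFn_add (heat t f) (heat t g)] with x h1 h2 h3 h4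
    rw [h1, h4, Pi.add_apply, h2, h3]
    refine (hasSum_heatFun ht (integrable_coe (f + g)) x).unique ?_
    convert (hasSum_heatFun ht (integrable_coe f) x).add
      (hasSum_heatFun ht (integrable_coe g) x) using 2 with k
    rw [← sineCoeffL_apply, map_add, sineCoeffL_apply, sineCoeffL_apply]
    ring
  · simp [heat, ht]

lemma heat_smul (t c : ℝ) (f : LpI p) : heat t (c • f) = c • heat t f := by
  by_cases ht : 0 < t
  · apply Lp.ext
    filter_upwards [coeFn_heat ht (c • f), coeFn_heat ht f,
      Lp.coeFn_smul c (heat t f)] with x h1 h2 h4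
    rw [h1, h4, Pi.smul_apply, h2, smul_eq_mul]
    refine (hasSum_heatFun ht (integrable_coe (c • f)) x).unique ?_
    refine (congrArg (fun F : ℕ → ℝ => HasSum F _) (funext fun k => ?_)).mpr
      ((hasSum_heatFun ht (integrable_coe f) x).mul_left c)
    rw [← sineCoeffL_apply, map_smul, sineCoeffL_apply, smul_eq_mul]
    ring
  · simp [heat, ht]

lemma continuousOn_heat (f : LpI p) : ContinuousOn (fun t => heat t f) (Ioi 0) := by
  intro t₀ ht₀
  have ht₀' : (0 : ℝ) < t₀ := ht₀
  refine ContinuousAt.continuousWithinAt ?_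
  rw [ContinuousAt, tendsto_iff_norm_sub_tendsto_zero]
  set B := (√(2 / Real.pi) * ∫ y, |(f : ℝ → ℝ) y| ∂intervalMeasure) * √(2 / Real.pi) with hB
  have hB0 : 0 ≤ B := mul_nonneg (mul_nonneg (Real.sqrt_nonneg _)
    (integral_nonneg fun _ => abs_nonneg _)) (Real.sqrt_nonneg _)
  set M := ((measureUnivNNReal intervalMeasure : ℝ) ^ p.toReal⁻¹) with hM
  have hlim : Tendsto (fun t => M * ((∑' k : ℕ, |Real.exp (-((k + 1 : ℕ) : ℝ) ^ 2 * t) -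
        Real.exp (-((k + 1 : ℕ) : ℝ) ^ 2 * t₀)|) * B)) (𝓝 t₀) (𝓝 (M * (0 * B))) := by
    refine Tendsto.const_mul _ (Tendsto.mul_const _ ?_)
    have h0 : (0 : ℝ) = ∑' _ : ℕ, (0 : ℝ) := tsum_zero.symm
    rw [h0]
    refine tendsto_tsum_of_dominated_convergence (bound := fun k : ℕ =>
      Real.exp (-((k + 1 : ℕ) : ℝ) ^ 2 * (t₀ / 2)) + Real.exp (-((k + 1 : ℕ) : ℝ) ^ 2 * t₀))
      ((summable_exp (half_pos ht₀')).add (summable_exp ht₀')) (fun k => ?_) ?_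
    · have : Continuous fun t => |Real.exp (-((k + 1 : ℕ) : ℝ) ^ 2 * t) -
        Real.exp (-((k + 1 : ℕ) : ℝ) ^ 2 * t₀)| := by fun_prop
      simpa using this.tendsto t₀
    · filter_upwards [lt_mem_nhds (half_lt_self ht₀')] with t ht k
      rw [Real.norm_eq_abs, abs_abs]
      refine (abs_sub _ _).trans ?_
      rw [Real.abs_exp, Real.abs_exp]
      refine add_le_add (Real.exp_le_exp.2 ?_) le_rfl
      nlinarith [sq_nonneg (((k + 1 : ℕ) : ℝ))]
  rw [zero_mul, mul_zero] at hlim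
  refine squeeze_zero' (Eventually.of_forall fun t => norm_nonneg _) ?_ hlim
  filter_upwards [lt_mem_nhds ht₀'] with t ht
  refine norm_le_of_bound (mul_nonneg (tsum_nonneg fun _ => abs_nonneg _) hB0) ?_
  filter_upwards [coeFn_heat ht f, coeFn_heat ht₀' f, Lp.coeFn_sub (heat t f) (heat t₀ f)]
    with x h1 h2 h3
  rw [h3, Pi.sub_apply, h1, h2]
  exact abs_heatFun_sub_le ht ht₀' (integrable_coe f) x

lemma integrableOn_truncated {σ ε : ℝ} (hσ : 0 < σ) (hε : 0 < ε) (f : LpI p) :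
    IntegrableOn (fun t : ℝ => (t ^ (1 + σ / 2))⁻¹ • (heat t f - f)) (Ioi ε) := by
  have hsub : Ioi ε ⊆ Ioi (0 : ℝ) := Ioi_subset_Ioi hε.le
  set A := (∑' k : ℕ, Real.exp (-((k + 1 : ℕ) : ℝ) ^ 2 * ε)) *
      ((√(2 / Real.pi) * ∫ y, |(f : ℝ → ℝ) y| ∂intervalMeasure) * √(2 / Real.pi)) with hA
  have hA0 : 0 ≤ A := mul_nonneg (tsum_nonneg fun _ => (Real.exp_pos _).le)
    (mul_nonneg (mul_nonneg (Real.sqrt_nonneg _)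
    (integral_nonneg fun _ => abs_nonneg _)) (Real.sqrt_nonneg _))
  set M := ((measureUnivNNReal intervalMeasure : ℝ) ^ p.toReal⁻¹) with hM
  have hpow : IntegrableOn (fun t : ℝ => t ^ (-(1 + σ / 2)) * (M * A + ‖f‖)) (Ioi ε) :=
    (integrableOn_Ioi_rpow_of_lt (by linarith) hε).mul_const _
  refine Integrable.mono' hpow ?_ ?_
  · refine ContinuousOn.aestronglyMeasurable ?_ measurableSet_Ioi
    have hc : ContinuousOn (fun t : ℝ => t ^ (1 + σ / 2)) (Ioi ε) :=
      ContinuousOn.rpow_const continuousOn_id fun t ht => Or.inl (ne_of_gt (hsub ht))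
    exact ContinuousOn.smul
      (hc.inv₀ fun t ht => (Real.rpow_pos_of_pos (hsub ht) _).ne')
      (((continuousOn_heat f).mono hsub).sub continuousOn_const)
  · refine (ae_restrict_iff' measurableSet_Ioi).2 (Eventually.of_forall fun t ht => ?_)
    have ht0 : (0 : ℝ) < t := hsub ht
    rw [norm_smul, Real.rpow_neg ht0.le, Real.norm_of_nonneg
      (inv_nonneg.2 (Real.rpow_nonneg ht0.le _))]
    refine mul_le_mul_of_nonneg_left ((norm_sub_le _ _).trans (add_le_add ?_ le_rfl))
      (inv_nonneg.2 (Real.rpow_nonneg ht0.le _))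
    refine norm_le_of_bound hA0 ?_
    filter_upwards [coeFn_heat ht0 f] with x hx
    rw [hx]
    exact abs_heatFun_le hε (le_of_lt ht) (integrable_coe f) x

lemma IsLaplacian.add {f g f' g' : LpI p} (h : IsLaplacian f g) (h' : IsLaplacian f' g') :
    IsLaplacian (f + f') (g + g') := by
  refine (Tendsto.add h h').congr fun t => ?_
  rw [heat_add, ← smul_add]
  congr 1
  abel

lemma IsLaplacian.smul (c : ℝ) {f g : LpI p} (h : IsLaplacian f g) :
    IsLaplacian (c • f) (c • g) := by
  refine (Tendsto.const_smul h c).congr fun t => ?_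
  rw [heat_smul, ← smul_sub, smul_comm]

lemma IsNegLaplacianPow.add {n : ℕ} {f g f' g' : LpI p} (h : IsNegLaplacianPow n f g)
    (h' : IsNegLaplacianPow n f' g') : IsNegLaplacianPow n (f + f') (g + g') := by
  induction n generalizing f f' with
  | zero => simp only [IsNegLaplacianPow] at *; rw [h, h']
  | succ n ih =>
    obtain ⟨u, hu, hu'⟩ := h
    obtain ⟨v, hv, hv'⟩ := h'
    refine ⟨u + v, hu.add hv, ?_⟩
    rw [neg_add]
    exact ih hu' hv'

lemma IsNegLaplacianPow.smul (c : ℝ) {n : ℕ} {f g : LpI p} (h : IsNegLaplacianPow n f g) :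
    IsNegLaplacianPow n (c • f) (c • g) := by
  induction n generalizing f with
  | zero => simp only [IsNegLaplacianPow] at *; rw [h]
  | succ n ih =>
    obtain ⟨u, hu, hu'⟩ := h
    refine ⟨c • u, hu.smul c, ?_⟩
    rw [← smul_neg]
    exact ih hu'

lemma IsNegLaplacianPow.unique {n : ℕ} {f g g' : LpI p} (h : IsNegLaplacianPow n f g)
    (h' : IsNegLaplacianPow n f g') : g = g' := by
  induction n generalizing f with
  | zero => simp only [IsNegLaplacianPow] at *; rw [h, h']
  | succ n ih =>
    obtain ⟨u, hu, hu'⟩ := h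
    obtain ⟨v, hv, hv'⟩ := h'
    obtain rfl : u = v := tendsto_nhds_unique hu hv
    exact ih hu' hv'

lemma IsFracLaplacianLow.add {σ : ℝ} {f g f' g' : LpI p} (h : IsFracLaplacianLow σ f g)
    (h' : IsFracLaplacianLow σ f' g') : IsFracLaplacianLow σ (f + f') (g + g') := by
  unfold IsFracLaplacianLow at *
  split_ifs at * with hσ
  · refine (Tendsto.add h h').congr' ?_
    filter_upwards [self_mem_nhdsWithin] with ε hε
    rw [← smul_add, ← integral_add (integrableOn_truncated hσ hε f)
      (integrableOn_truncated hσ hε f')]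
    congr 2
    ext1 t
    rw [heat_add, ← smul_add]
    congr 1
    abel
  · rw [h, h']

lemma IsFracLaplacianLow.smul (c : ℝ) {σ : ℝ} {f g : LpI p} (h : IsFracLaplacianLow σ f g) :
    IsFracLaplacianLow σ (c • f) (c • g) := by
  unfold IsFracLaplacianLow at *
  split_ifs at * with hσ
  · refine (Tendsto.const_smul h c).congr fun ε => ?_
    rw [smul_comm, ← integral_smul]
    congr 2
    ext1 t
    rw [heat_smul, ← smul_sub, smul_comm]
  · rw [h]

lemma IsFracLaplacianLow.unique {σ : ℝ} {f g g' : LpI p} (h : IsFracLaplacianLow σ f g)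
    (h' : IsFracLaplacianLow σ f g') : g = g' := by
  unfold IsFracLaplacianLow at *
  split_ifs at * with hσ
  · exact tendsto_nhds_unique h h'
  · rw [h, h']

lemma IsFracLaplacian.unique {s : ℝ} {f g g' : LpI p} (h : IsFracLaplacian s f g)
    (h' : IsFracLaplacian s f g') : g = g' := by
  obtain ⟨u, hu, hu'⟩ := h
  obtain ⟨v, hv, hv'⟩ := h'
  obtain rfl := hu.unique hv
  exact hu'.unique hv'

lemma integral_sineMode_mul (j k : ℕ) :
    ∫ x, sineMode (j + 1) x * sineMode (k + 1) x ∂intervalMeasure = if j = k then 1 else 0 := by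
  have hπ := Real.pi_pos
  have e : ∀ x : ℝ, sineMode (j + 1) x * sineMode (k + 1) x =
      (1 / Real.pi) * (Real.cos (((j : ℤ) - k : ℤ) * x) -
        Real.cos (((j : ℤ) + k + 2 : ℤ) * x)) := fun x => by
    have h1 : √(2 / Real.pi) * √(2 / Real.pi) = 2 / Real.pi :=
      Real.mul_self_sqrt (by positivity)
    have h2 := Real.cos_add (((j + 1 : ℕ) : ℝ) * x) (((k + 1 : ℕ) : ℝ) * x)
    have h3 := Real.cos_sub (((j + 1 : ℕ) : ℝ) * x) (((k + 1 : ℕ) : ℝ) * x)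
    have h4 : (((j : ℤ) - k : ℤ) : ℝ) * x = ((j + 1 : ℕ) : ℝ) * x - ((k + 1 : ℕ) : ℝ) * x := by
      push_cast; ring
    have h5 : (((j : ℤ) + k + 2 : ℤ) : ℝ) * x = ((j + 1 : ℕ) : ℝ) * x + ((k + 1 : ℕ) : ℝ) * x := by
      push_cast; ring
    rw [h4, h5, h2, h3]
    unfold sineMode
    linear_combination (Real.sin (((j + 1 : ℕ) : ℝ) * x) * Real.sin (((k + 1 : ℕ) : ℝ) * x)) * h1
  have c0 : ∀ n : ℤ, n ≠ 0 → ∫ x in (0 : ℝ)..Real.pi, Real.cos (n * x) = 0 := fun n hn => by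
    have hn' : (n : ℝ) ≠ 0 := by exact_mod_cast hn
    rw [intervalIntegral.integral_comp_mul_left (fun x => Real.cos x) hn', integral_cos]
    simp [Real.sin_int_mul_pi]
  rw [← integral_Ioc_eq_integral_Ioo, ← intervalIntegral.integral_of_le hπ.le]
  simp only [e]
  rw [intervalIntegral.integral_const_mul, intervalIntegral.integral_sub
    (Continuous.intervalIntegrable (by fun_prop) _ _)
    (Continuous.intervalIntegrable (by fun_prop) _ _), c0 ((j : ℤ) + k + 2) (by omega)]
  split_ifs with h
  · subst h
    simp [hπ.ne']
  · rw [c0 _ (by omega)]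
    simp

/-- `e^{tΔ}` multiplies the `k`-th sine coefficient by `exp (-k² t)`. -/
lemma sineCoeffL_heat {t : ℝ} (ht : 0 < t) (k : ℕ) (f : LpI p) :
    sineCoeffL k (heat t f) = Real.exp (-((k + 1 : ℕ) : ℝ) ^ 2 * t) * sineCoeffL k f := by
  rw [sineCoeffL_apply, sineCoeffL_apply, sineCoeff_congr k (coeFn_heat ht f)]
  set B := (√(2 / Real.pi) * ∫ y, |(f : ℝ → ℝ) y| ∂intervalMeasure) * √(2 / Real.pi) with hB
  have hint : ∀ j, Integrable (fun x => sineMode (k + 1) x *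
      (Real.exp (-((j + 1 : ℕ) : ℝ) ^ 2 * t) * (sineCoeff j f * sineMode (j + 1) x)))
      intervalMeasure := fun j => by
    refine integrable_sineMode_mul _ ?_
    refine Integrable.const_mul (Integrable.const_mul ?_ _) _
    simpa using integrable_sineMode_mul (j + 1) (integrable_const (μ := intervalMeasure) (1 : ℝ))
  have key := hasSum_integral_of_summable_integral_norm (μ := intervalMeasure) hint ?_
  · have e1 : sineCoeff k (heatFun t f) = ∫ x, ∑' j, sineMode (k + 1) x *
      (Real.exp (-((j + 1 : ℕ) : ℝ) ^ 2 * t) * (sineCoeff j f * sineMode (j + 1) x))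
        ∂intervalMeasure := by
      unfold sineCoeff
      refine integral_congr_ae (Eventually.of_forall fun x => ?_)
      simp only
      rw [tsum_mul_left, ← (hasSum_heatFun ht (integrable_coe f) x).tsum_eq]
      rfl
    rw [e1]
    refine key.unique ?_
    have e2 : ∀ j, ∫ x, sineMode (k + 1) x *
        (Real.exp (-((j + 1 : ℕ) : ℝ) ^ 2 * t) * (sineCoeff j f * sineMode (j + 1) x))
        ∂intervalMeasure = if j = k then
          Real.exp (-((k + 1 : ℕ) : ℝ) ^ 2 * t) * sineCoeff k f else 0 := fun j => by
      have e3 : ∀ x, sineMode (k + 1) x *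
        (Real.exp (-((j + 1 : ℕ) : ℝ) ^ 2 * t) * (sineCoeff j f * sineMode (j + 1) x)) =
        (Real.exp (-((j + 1 : ℕ) : ℝ) ^ 2 * t) * sineCoeff j f) *
          (sineMode (j + 1) x * sineMode (k + 1) x) := fun x => by ring
      simp only [e3]
      rw [integral_const_mul, integral_sineMode_mul]
      split_ifs with h
      · rw [h, mul_one]
      · rw [mul_zero]
    simp only [e2]
    exact hasSum_ite_eq k _
  · refine Summable.of_nonneg_of_le (fun j => integral_nonneg fun y => norm_nonneg _)
      (fun j => ?_) ((summable_exp ht).mul_right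
        (∫ _, √(2 / Real.pi) * B ∂intervalMeasure))
    rw [← integral_const_mul]
    refine integral_mono (hint j).norm (integrable_const _) fun x => ?_
    simp only [norm_mul, Real.norm_eq_abs, Real.abs_exp]
    have e1 := abs_sineMode_le (k + 1) x
    have e2 := abs_heatFun_term_le j (integrable_coe f) x
    rw [abs_mul] at e2
    have e4 : |sineMode (k + 1) x| * (|sineCoeff j f| * |sineMode (j + 1) x|) ≤
        √(2 / Real.pi) * B :=
      mul_le_mul e1 e2 (by positivity) (Real.sqrt_nonneg _)
    calc _ = Real.exp (-((j + 1 : ℕ) : ℝ) ^ 2 * t) *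
          (|sineMode (k + 1) x| * (|sineCoeff j f| * |sineMode (j + 1) x|)) := by ring
      _ ≤ _ := mul_le_mul_of_nonneg_left e4 (Real.exp_pos _).le

/-- Completeness of the sine system. -/
lemma ae_eq_zero_of_sineCoeff_eq_zero {h : ℝ → ℝ} (hh : Integrable h intervalMeasure)
    (h0 : ∀ k, sineCoeff k h = 0) : h =ᵐ[intervalMeasure] 0 := by
  have hbdd : ∀ {g : ℝ → ℝ}, Continuous g → (∃ C, ∀ x, ‖g x‖ ≤ C) →
      Integrable (fun x => g x * h x) intervalMeasure := fun hg ⟨C, hC⟩ =>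
    hh.bdd_mul hg.aestronglyMeasurable (Eventually.of_forall hC)
  have hb1 : ∀ (k n : ℕ), Integrable
      (fun x => (Real.sin (k * x) * Real.cos x ^ n) * h x) intervalMeasure := fun k n =>
    hbdd (by fun_prop) ⟨1, fun x => by
      rw [norm_mul, norm_pow]
      exact mul_le_one₀ (Real.abs_sin_le_one _) (by positivity)
        (pow_le_one₀ (norm_nonneg _) (Real.abs_cos_le_one _))⟩
  have step1 : ∀ (n k : ℕ),
      ∫ x, (Real.sin (k * x) * Real.cos x ^ n) * h x ∂intervalMeasure = 0 := by
    intro n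
    induction n with
    | zero =>
      intro k
      cases k with
      | zero => simp
      | succ k =>
        have h1 := h0 k
        unfold sineCoeff sineMode at h1
        simp only [mul_assoc] at h1
        rw [integral_const_mul] at h1
        have h2 : √(2 / Real.pi) ≠ 0 := (Real.sqrt_pos.2 (by positivity)).ne'
        simpa using (mul_eq_zero.1 h1).resolve_left h2
    | succ n ih =>
      intro k
      cases k with
      | zero => simp
      | succ k =>
        have e : ∀ x : ℝ, (Real.sin ((k + 1 : ℕ) * x) * Real.cos x ^ (n + 1)) * h x =
            (1 / 2) * ((Real.sin ((k + 2 : ℕ) * x) * Real.cos x ^ n) * h x +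
              (Real.sin (k * x) * Real.cos x ^ n) * h x) := fun x => by
          have a1 := Real.sin_add (((k + 1 : ℕ) : ℝ) * x) x
          have a2 := Real.sin_sub (((k + 1 : ℕ) : ℝ) * x) x
          have a3 : ((k + 2 : ℕ) : ℝ) * x = ((k + 1 : ℕ) : ℝ) * x + x := by push_cast; ring
          have a4 : (k : ℝ) * x = ((k + 1 : ℕ) : ℝ) * x - x := by push_cast; ring
          rw [a3, a4, a1, a2]
          ring
        simp only [e]
        rw [integral_const_mul, integral_add (hb1 _ _) (hb1 _ _), ih, ih]
        simp
  have hbq : ∀ q : Polynomial ℝ, Integrable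
      (fun x => (Real.sin x * q.eval (Real.cos x)) * h x) intervalMeasure := fun q => by
    obtain ⟨C, hC⟩ := (isCompact_Icc (a := (-1 : ℝ)) (b := 1)).exists_bound_of_continuousOn
      q.continuous.continuousOn
    refine hbdd (Real.continuous_sin.mul (q.continuous.comp Real.continuous_cos))
      ⟨1 * C, fun x => ?_⟩
    rw [norm_mul]
    exact mul_le_mul (Real.abs_sin_le_one _) (hC _ (Real.cos_mem_Icc x)) (norm_nonneg _)
      zero_le_one
  have step2 : ∀ q : Polynomial ℝ,
      ∫ x, (Real.sin x * q.eval (Real.cos x)) * h x ∂intervalMeasure = 0 := by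
    intro q
    induction q using Polynomial.induction_on' with
    | add q r hq hr =>
      simp only [Polynomial.eval_add, mul_add, add_mul]
      rw [integral_add (hbq q) (hbq r), hq, hr, add_zero]
    | monomial n a =>
      have e : ∀ x : ℝ, (Real.sin x * (Polynomial.monomial n a).eval (Real.cos x)) * h x =
          a * ((Real.sin ((1 : ℕ) * x) * Real.cos x ^ n) * h x) := fun x => by
        rw [Polynomial.eval_monomial]; push_cast; rw [one_mul]; ring
      simp only [e]
      rw [integral_const_mul, step1, mul_zero]
  have hsin : Integrable (fun x => Real.sin x * h x) intervalMeasure :=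
    hbdd Real.continuous_sin ⟨1, Real.abs_sin_le_one⟩
  have step3 : ∀ᵐ x ∂intervalMeasure, Real.sin x * h x = 0 := by
    refine ae_eq_zero_of_integral_contDiff_smul_eq_zero hsin.locallyIntegrable
      fun g hg hgc => ?_
    have hgi : Integrable (fun x => g x • (Real.sin x * h x)) intervalMeasure := by
      obtain ⟨C, hC⟩ := hgc.exists_bound_of_continuous hg.continuous
      exact hsin.bdd_mul hg.continuous.aestronglyMeasurable (Eventually.of_forall hC)
    set N := ∫ x, |h x| ∂intervalMeasure with hN
    have hN0 : 0 ≤ N := integral_nonneg fun _ => abs_nonneg _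
    have hle : ∀ ε > 0, |∫ x, g x • (Real.sin x * h x) ∂intervalMeasure| ≤ 0 + ε := by
      intro ε hε
      obtain ⟨q, hq⟩ := exists_polynomial_near_of_continuousOn (-1) 1
        (fun u => g (Real.arccos u)) (hg.continuous.comp Real.continuous_arccos).continuousOn
        (ε / (N + 1)) (by positivity)
      rw [zero_add, ← sub_zero (∫ x, g x • (Real.sin x * h x) ∂intervalMeasure), ← step2 q,
        ← integral_sub hgi (hbq q)]
      refine (abs_integral_le_integral_abs).trans ?_
      calc _ ≤ ∫ x, (ε / (N + 1)) * |h x| ∂intervalMeasure := by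
            refine integral_mono_ae (hgi.sub (hbq q)).abs (hh.abs.const_mul _) ?_
            refine (ae_restrict_iff' measurableSet_Ioo).2 (Eventually.of_forall fun x hx => ?_)
            have h1 := hq (Real.cos x) (Real.cos_mem_Icc x)
            rw [Real.arccos_cos hx.1.le hx.2.le] at h1
            have h2 : g x • (Real.sin x * h x) - (Real.sin x * q.eval (Real.cos x)) * h x =
                -(q.eval (Real.cos x) - g x) * Real.sin x * h x := by
              rw [smul_eq_mul]; ring
            simp only [h2, abs_mul, abs_neg]
            refine mul_le_mul_of_nonneg_right ?_ (abs_nonneg _)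
            exact (mul_le_of_le_one_right (abs_nonneg _) (Real.abs_sin_le_one _)).trans h1.le
        _ = ε * (N / (N + 1)) := by rw [integral_const_mul]; ring
        _ ≤ ε * 1 := by
            refine mul_le_mul_of_nonneg_left ?_ hε.le
            exact (div_le_one (by linarith)).2 (by linarith)
        _ = ε := mul_one _
    exact abs_nonpos_iff.1 (le_of_forall_pos_le_add hle)
  have hmem : ∀ᵐ x ∂intervalMeasure, x ∈ Ioo 0 Real.pi := ae_restrict_mem measurableSet_Ioo
  filter_upwards [step3, hmem] with x h1 h2
  exact (mul_eq_zero.1 h1).resolve_left (Real.sin_pos_of_mem_Ioo h2).ne'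

lemma eq_zero_of_sineCoeffL_eq_zero {f : LpI p} (h0 : ∀ k, sineCoeffL k f = 0) : f = 0 :=
  Lp.ext ((ae_eq_zero_of_sineCoeff_eq_zero (integrable_coe f) h0).trans
    (Lp.coeFn_zero ℝ p intervalMeasure).symm)

lemma IsLaplacian.sineCoeffL_eq {f g : LpI p} (h : IsLaplacian f g) (k : ℕ) :
    sineCoeffL k g = -((k + 1 : ℕ) : ℝ) ^ 2 * sineCoeffL k f := by
  have h1 := ((sineCoeffL (p := p) k).continuous.tendsto g).comp h
  have h2 : HasDerivAt (fun t : ℝ => Real.exp (-((k + 1 : ℕ) : ℝ) ^ 2 * t))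
      (-((k + 1 : ℕ) : ℝ) ^ 2) 0 := by
    simpa using ((hasDerivAt_id (0 : ℝ)).const_mul (-((k + 1 : ℕ) : ℝ) ^ 2)).exp
  have h3 := (h2.tendsto_slope_zero_right).mul_const (sineCoeffL k f)
  refine tendsto_nhds_unique h1 (h3.congr' ?_)
  filter_upwards [self_mem_nhdsWithin] with t ht
  simp only [Function.comp, map_smul, map_sub, sineCoeffL_heat ht, smul_eq_mul, zero_add,
    mul_zero, Real.exp_zero]
  ring

lemma IsNegLaplacianPow.eq_zero {n : ℕ} {f : LpI p} (h : IsNegLaplacianPow n f 0) : f = 0 := by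
  induction n generalizing f with
  | zero => exact h.symm
  | succ n ih =>
    obtain ⟨u, hu, hu'⟩ := h
    obtain rfl : u = 0 := neg_eq_zero.1 (ih hu')
    refine eq_zero_of_sineCoeffL_eq_zero fun k => ?_
    have h1 := hu.sineCoeffL_eq k
    rw [map_zero] at h1
    refine (mul_eq_zero.1 h1.symm).resolve_left (neg_ne_zero.2 ?_)
    positivity

lemma IsFracLaplacianLow.eq_zero {σ : ℝ} (hσ2 : σ < 2) {f : LpI p}
    (h : IsFracLaplacianLow σ f 0) : f = 0 := by
  unfold IsFracLaplacianLow at h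
  split_ifs at h with hσ
  · refine eq_zero_of_sineCoeffL_eq_zero fun k => ?_
    by_contra hne
    have hG : Real.Gamma (-σ / 2) ≠ 0 := Real.Gamma_ne_zero fun m hm => by
      cases m with
      | zero => rw [Nat.cast_zero] at hm; linarith
      | succ m => push_cast at hm; linarith [Nat.cast_nonneg (α := ℝ) m]
    set w : ℝ → ℝ := fun t => (t ^ (1 + σ / 2))⁻¹ *
      (1 - Real.exp (-((k + 1 : ℕ) : ℝ) ^ 2 * t)) with hw
    have h1 := ((sineCoeffL (p := p) k).continuous.tendsto 0).comp h
    have e : ∀ ε > 0, IntegrableOn w (Ioi ε) ∧ sineCoeffL k ((Real.Gamma (-σ / 2))⁻¹ •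
        ∫ t in Ioi ε, (t ^ (1 + σ / 2))⁻¹ • (heat t f - f)) =
        -((Real.Gamma (-σ / 2))⁻¹ * sineCoeffL k f) * ∫ t in Ioi ε, w t := by
      intro ε hε
      have i1 := integrableOn_truncated hσ hε f
      have e1 : ∀ t ∈ Ioi ε, sineCoeffL k ((t ^ (1 + σ / 2))⁻¹ • (heat t f - f)) =
          -sineCoeffL k f * w t := fun t ht => by
        rw [map_smul, map_sub, sineCoeffL_heat (hε.trans ht), smul_eq_mul, hw]
        ring
      refine ⟨?_, ?_⟩
      · have i2 : IntegrableOn (fun t => -sineCoeffL k f * w t) (Ioi ε) :=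
          IntegrableOn.congr_fun ((sineCoeffL (p := p) k).integrable_comp i1) e1
            measurableSet_Ioi
        have i3 := i2.const_mul (-sineCoeffL k f)⁻¹
        refine IntegrableOn.congr_fun i3 (fun t _ => ?_) measurableSet_Ioi
        rw [← mul_assoc, inv_mul_cancel₀ (neg_ne_zero.2 hne), one_mul]
      · rw [map_smul, ← ContinuousLinearMap.integral_comp_comm _ i1,
          setIntegral_congr_fun measurableSet_Ioi e1, integral_const_mul, smul_eq_mul]
        ring
    have hwpos : ∀ t : ℝ, 0 < t → 0 < w t := fun t ht => by
      refine mul_pos (inv_pos.2 (Real.rpow_pos_of_pos ht _)) (sub_pos.2 ?_)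
      rw [Real.exp_lt_one_iff]
      have : 0 < ((k + 1 : ℕ) : ℝ) ^ 2 := by positivity
      nlinarith
    have hI : 0 < ∫ t in Ioi (1 : ℝ), w t := by
      rw [setIntegral_pos_iff_support_of_nonneg_ae
        ((ae_restrict_iff' measurableSet_Ioi).2 (Eventually.of_forall fun t ht =>
          (hwpos t (zero_lt_one.trans ht)).le)) (e 1 one_pos).1]
      have : Function.support w ∩ Ioi 1 = Ioi 1 :=
        inter_eq_right.2 fun t ht => (hwpos t (zero_lt_one.trans ht)).ne'
      rw [this]
      simp
    have h2 := h1.abs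
    rw [map_zero, abs_zero] at h2
    have hA : 0 < |(Real.Gamma (-σ / 2))⁻¹ * sineCoeffL k f| * ∫ t in Ioi (1 : ℝ), w t :=
      mul_pos (abs_pos.2 (mul_ne_zero (inv_ne_zero hG) hne)) hI
    have h3 : |(Real.Gamma (-σ / 2))⁻¹ * sineCoeffL k f| * ∫ t in Ioi (1 : ℝ), w t ≤ 0 := by
      refine ge_of_tendsto h2 ?_
      filter_upwards [Ioo_mem_nhdsGT (zero_lt_one' ℝ)] with ε hε
      simp only [Function.comp]
      rw [(e ε hε.1).2, abs_mul (-_), abs_neg]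
      refine mul_le_mul_of_nonneg_left (le_trans ?_ (le_abs_self _)) (abs_nonneg _)
      refine setIntegral_mono_set (e ε hε.1).1 ?_ (Ioi_subset_Ioi hε.2.le).eventuallyLE
      exact (ae_restrict_iff' measurableSet_Ioi).2 (Eventually.of_forall fun t ht =>
          (hwpos t (hε.1.trans ht)).le)
    linarith
  · exact h.symm

/-! ### The fractional Sobolev spaces -/

/-- The set of all `f ∈ L_p(0, π)` for which `(-Δ)^{s/2} f` exists in `L_p(0, π)`. -/
def fracDomain (s : ℝ) (p : ℝ≥0∞) [Fact (1 ≤ p)] : Submodule ℝ (LpI p) where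
  carrier := {f | ∃ g, IsFracLaplacian s f g}
  add_mem' := by
    rintro f f' ⟨g, u, hu, hg⟩ ⟨g', u', hu', hg'⟩
    exact ⟨g + g', u + u', hu.add hu', hg.add hg'⟩
  zero_mem' := by
    have h1 : ∀ t, heat t (0 : LpI p) = 0 := fun t => by
      simpa using heat_smul t 0 (0 : LpI p)
    have h2 : ∀ n, IsNegLaplacianPow n (0 : LpI p) 0 := fun n => by
      induction n with
      | zero => rfl
      | succ n ih => exact ⟨0, by simp [IsLaplacian, h1], by simpa using ih⟩
    exact ⟨0, 0, h2 _, by simp [IsFracLaplacianLow, h1]⟩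
  smul_mem' := by
    rintro c f ⟨g, u, hu, hg⟩
    exact ⟨c • g, c • u, hu.smul c, hg.smul c⟩

/-- The fractional Sobolev space `H^s_p(0, π)`, for `s ≥ 0`. Its norm is
`‖f‖ = ‖(-Δ)^{s/2} f‖_{L_p(0, π)}`. -/
def HSpace (s : ℝ) (p : ℝ≥0∞) [Fact (1 ≤ p)] : Type := ↥(fracDomain s p)

namespace HSpace

variable {s : ℝ}

instance : AddCommGroup (HSpace s p) := inferInstanceAs (AddCommGroup ↥(fracDomain s p))

instance : Module ℝ (HSpace s p) := inferInstanceAs (Module ℝ ↥(fracDomain s p))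

/-- The inclusion of `H^s_p(0, π)` in `L_p(0, π)`. -/
def toLp : HSpace s p →ₗ[ℝ] LpI p := (fracDomain s p).subtype

lemma exists_fracLaplacian (f : HSpace s p) : ∃ g, IsFracLaplacian s (toLp f) g := f.2

/-- The operator `(-Δ)^{s/2} : H^s_p(0, π) → L_p(0, π)`. -/
def fracLaplacian : HSpace s p →ₗ[ℝ] LpI p where
  toFun f := (exists_fracLaplacian f).choose
  map_add' f f' := by
    obtain ⟨u, hu, hg⟩ := (exists_fracLaplacian f).choose_spec
    obtain ⟨u', hu', hg'⟩ := (exists_fracLaplacian f').choose_spec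
    exact (exists_fracLaplacian (f + f')).choose_spec.unique ⟨u + u', hu.add hu', hg.add hg'⟩
  map_smul' c f := by
    obtain ⟨u, hu, hg⟩ := (exists_fracLaplacian f).choose_spec
    exact (exists_fracLaplacian (c • f)).choose_spec.unique ⟨c • u, hu.smul c, hg.smul c⟩

lemma fracLaplacian_spec (f : HSpace s p) : IsFracLaplacian s (toLp f) (fracLaplacian f) :=
  (exists_fracLaplacian f).choose_spec

lemma fracLaplacian_injective :
    Function.Injective (fracLaplacian : HSpace s p →ₗ[ℝ] LpI p) := by
  rw [injective_iff_map_eq_zero]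
  intro f hf
  obtain ⟨u, hu, hg⟩ := fracLaplacian_spec f
  rw [hf] at hg
  have hs : s - 2 * ⌊s / 2⌋₊ < 2 := by linarith [Nat.lt_floor_add_one (s / 2)]
  obtain rfl := hg.eq_zero hs
  exact Subtype.ext hu.eq_zero

instance : NormedAddCommGroup (HSpace s p) :=
  NormedAddCommGroup.induced (HSpace s p) (LpI p) fracLaplacian fracLaplacian_injective

instance : NormedSpace ℝ (HSpace s p) :=
  NormedSpace.induced ℝ (HSpace s p) (LpI p) fracLaplacian

lemma norm_def (f : HSpace s p) : ‖f‖ = ‖fracLaplacian f‖ := rfl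

end HSpace

/-- The space `L_∞(0, T; H^s_p(0, π))` (Bochner measurable, essentially bounded functions of
time, modulo equality almost everywhere). -/
abbrev LinftyH (T s : ℝ) (p : ℝ≥0∞) [Fact (1 ≤ p)] : Type :=
  Lp (HSpace s p) ∞ (volume.restrict (Ioo 0 T))

/-- A representative `(t, x) ↦ f(t, x)` of an element of `L_∞(0, T; H^s_p(0, π))`. -/
def LinftyH.toFun {T s : ℝ} (f : LinftyH T s p) (t x : ℝ) : ℝ :=
  (HSpace.toLp ((f : ℝ → HSpace s p) t) : ℝ → ℝ) x

end DirichletHeat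

end

/-! Write g(s) = (-Δ)^{γ/2} f(s), so that ‖g(s)‖_p is the H^γ_p norm of f(s). Formally, (-Δ)^{1+β/2}
applied to the solution at time t is the integral over s in (0,t) of (-Δ)^{β/2} (-Δ)^{(2-γ)/2}
e^{(t-s)Δ} g(s). Each fractional power of order σ costs (t-s)^{-σ/2}, so the integrand is at most a
constant times (t-s)^{(γ-β)/2-1}. This is integrable because β < γ, and its integral is a multiple
of t^{(γ-β)/2}.

The smoothing estimates must have constants independent of p, including p = 1. They rest on the
bound ‖e^{(r+τ)Δ}f - e^{τΔ}f‖ ≤ 2‖f‖ min(1, r/τ) (`norm_heat_add_sub_heat_le`), which comes from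
positivity rather than from derivatives of the kernel. By Poisson summation √t·theta(t,z) is a sum
of Gaussians that increase with t (`sqrt_mul_theta_mono`). This controls the negative part of a time
increment of the theta function, hence an L_1 norm of the increment of the heat kernel, and Schur's
test passes to every L_p. Inserted in the formula for (-Δ)^{σ/2}, the factor min(1, r/τ) makes the
integral absolutely convergent and of size τ^{-σ/2} (`exists_isFracLaplacianLow`,
`exists_fracLaplacian_heat`).

The formal computation is justified on sine coefficients, which determine an element of L_p.
`exists_integrated_solution` constructs h = -Δu and G = (-Δ)^{β/2}h as Bochner integrals, moving
limits of bounded operators inside by dominated convergence. `isLaplacian_of_sineCoeffL` recovers u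
from h. `modeConv_spec` identifies the sine series of u with the convolution and gives absolute
convergence of the time integral. Measurability in t is also tested on coefficients
(`aestronglyMeasurable_of_sineCoeffL`). -/

noncomputable section

namespace DirichletHeat

/-! ### The theta function and pointwise bounds of the heat kernel -/

/-- The theta function `1 + 2 ∑_{k ≥ 1} exp (-k² t) cos (k z)`. -/
def theta (t z : ℝ) : ℝ :=
  1 + 2 * ∑' k : ℕ, Real.exp (-((k + 1 : ℕ) : ℝ) ^ 2 * t) * Real.cos ((k + 1 : ℕ) * z)

lemma summable_exp_mul_cos {t : ℝ} (ht : 0 < t) (z : ℝ) :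
    Summable fun k : ℕ => Real.exp (-((k + 1 : ℕ) : ℝ) ^ 2 * t) * Real.cos ((k + 1 : ℕ) * z) := by
  refine Summable.of_norm_bounded (summable_exp ht) fun k => ?_
  rw [norm_mul, Real.norm_of_nonneg (Real.exp_pos _).le]
  exact mul_le_of_le_one_right (Real.exp_pos _).le (Real.abs_cos_le_one _)

lemma hasSum_theta_int {t : ℝ} (ht : 0 < t) (z : ℝ) :
    HasSum (fun n : ℤ => Real.exp (-(n : ℝ) ^ 2 * t) * Real.cos (n * z)) (theta t z) := by
  set S := ∑' k : ℕ, Real.exp (-((k + 1 : ℕ) : ℝ) ^ 2 * t) * Real.cos ((k + 1 : ℕ) * z) with hS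
  have h := (summable_exp_mul_cos ht z).hasSum
  have h1 : HasSum (fun n : ℕ => (fun n : ℤ => Real.exp (-(n : ℝ) ^ 2 * t) * Real.cos (n * z)) n)
      (S + 1) := by
    rw [← hasSum_nat_add_iff' 1]
    simpa [hS] using h
  have h2 : HasSum (fun n : ℕ => (fun n : ℤ => Real.exp (-(n : ℝ) ^ 2 * t) * Real.cos (n * z))
      (-(n + 1 : ℤ))) S := by
    refine (congrArg (fun F : ℕ → ℝ => HasSum F _) (funext fun k => ?_)).mpr h
    have e : (((-(k + 1 : ℤ)) : ℤ) : ℝ) = -((k + 1 : ℕ) : ℝ) := by push_cast; ring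
    simp only [e, neg_sq, neg_mul, Real.cos_neg]
  have h3 := HasSum.of_nat_of_neg_add_one (f := fun n : ℤ => Real.exp (-(n : ℝ) ^ 2 * t) * Real.cos (n * z)) h1 h2
  convert h3 using 1
  rw [theta, ← hS]
  ring

lemma summable_exp_int {t : ℝ} (ht : 0 < t) :
    Summable fun n : ℤ => Real.exp (-(n : ℝ) ^ 2 * t) := by
  simpa using (hasSum_theta_int ht 0).summable

lemma summable_gaussian_shift {c : ℝ} (hc : 0 < c) (w : ℝ) :
    Summable fun n : ℤ => Real.exp (-c * ((n : ℝ) - w) ^ 2) := by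
  refine Summable.of_nonneg_of_le (fun n => (Real.exp_pos _).le) (fun n => ?_)
    ((summable_exp_int (half_pos hc)).mul_left (Real.exp (c * w ^ 2)))
  rw [← Real.exp_add]
  apply Real.exp_le_exp.2
  -- The exponents differ by (c/2)(n - 2w)² ≥ 0.
  nlinarith [mul_nonneg hc.le (sq_nonneg ((n : ℝ) - 2 * w))]

/-- Poisson summation for the theta function. -/
lemma theta_eq_gaussian {t : ℝ} (ht : 0 < t) (z : ℝ) :
    √t * theta t z = √Real.pi *
      ∑' n : ℤ, Real.exp (-(Real.pi ^ 2 / t) * ((n : ℝ) - z / (2 * Real.pi)) ^ 2) := by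
  have hπ := Real.pi_pos
  have hπc : (Real.pi : ℂ) ≠ 0 := by exact_mod_cast hπ.ne'
  have htc : (t : ℂ) ≠ 0 := by exact_mod_cast ht.ne'
  have ha : 0 < ((t / Real.pi : ℝ) : ℂ).re := by rw [Complex.ofReal_re]; positivity
  -- With a = t/π and b = iz/(2π), the left side is the theta series in exponential form, and the
  -- shift n + ib on the right becomes the real number n - z/(2π).
  have key := Complex.tsum_exp_neg_quadratic ha (Complex.I * (z / (2 * Real.pi) : ℝ))
  have e1 : ∀ n : ℤ, Complex.exp (-Real.pi * ((t / Real.pi : ℝ) : ℂ) * (n : ℂ) ^ 2 +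
      2 * Real.pi * (Complex.I * (z / (2 * Real.pi) : ℝ)) * n) =
      (Real.exp (-(n : ℝ) ^ 2 * t) : ℝ) * Complex.exp ((n * z : ℝ) * Complex.I) := fun n => by
    rw [Complex.ofReal_exp, ← Complex.exp_add]
    congr 1
    push_cast
    field_simp
    try ring
  have e2 : ∀ n : ℤ, Complex.exp (-Real.pi / ((t / Real.pi : ℝ) : ℂ) *
      ((n : ℂ) + Complex.I * (Complex.I * (z / (2 * Real.pi) : ℝ))) ^ 2) =
      (Real.exp (-(Real.pi ^ 2 / t) * ((n : ℝ) - z / (2 * Real.pi)) ^ 2) : ℝ) := fun n => by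
    rw [Complex.ofReal_exp, ← mul_assoc, Complex.I_mul_I]
    congr 1
    push_cast
    field_simp
    try ring
  have e3 : (1 : ℂ) / ((t / Real.pi : ℝ) : ℂ) ^ (1 / 2 : ℂ) = ((√Real.pi / √t : ℝ) : ℂ) := by
    have : ((1 / 2 : ℂ)) = ((1 / 2 : ℝ) : ℂ) := by push_cast; rfl
    rw [this, ← Complex.ofReal_cpow (by positivity), ← Real.sqrt_eq_rpow,
      Real.sqrt_div' _ hπ.le]
    push_cast
    rw [one_div_div]
  simp only [e1, e2, e3] at key
  have hs : Summable fun n : ℤ =>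
      ((Real.exp (-(n : ℝ) ^ 2 * t) : ℝ) : ℂ) * Complex.exp ((n * z : ℝ) * Complex.I) := by
    refine Summable.of_norm ?_
    simp only [norm_mul, Complex.norm_exp_ofReal_mul_I, mul_one, Complex.norm_real,
      Real.norm_eq_abs, Real.abs_exp]
    exact summable_exp_int ht
  have h1 := congrArg Complex.re key
  rw [Complex.re_tsum hs, ← Complex.ofReal_tsum, ← Complex.ofReal_mul, Complex.ofReal_re] at h1
  simp only [Complex.re_ofReal_mul, Complex.exp_ofReal_mul_I_re] at h1
  rw [(hasSum_theta_int ht z).tsum_eq] at h1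
  rw [h1]
  rw [← mul_assoc, mul_div_cancel₀ _ (Real.sqrt_pos.2 ht).ne']

lemma theta_nonneg {t : ℝ} (ht : 0 < t) (z : ℝ) : 0 ≤ theta t z := by
  have h := theta_eq_gaussian ht z
  have h1 : 0 ≤ √t * theta t z := by
    rw [h]
    exact mul_nonneg (Real.sqrt_nonneg _) (tsum_nonneg fun _ => (Real.exp_pos _).le)
  exact nonneg_of_mul_nonneg_right h1 (Real.sqrt_pos.2 ht)

/-- `t ↦ √t · theta t z` is nondecreasing. -/
lemma sqrt_mul_theta_mono {s t : ℝ} (hs : 0 < s) (hst : s ≤ t) (z : ℝ) :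
    √s * theta s z ≤ √t * theta t z := by
  have ht := hs.trans_le hst
  have hπ := Real.pi_pos
  rw [theta_eq_gaussian hs, theta_eq_gaussian ht]
  refine mul_le_mul_of_nonneg_left (Summable.tsum_le_tsum (fun n => Real.exp_le_exp.2 ?_)
    (summable_gaussian_shift (by positivity) _) (summable_gaussian_shift (by positivity) _))
    (Real.sqrt_nonneg _)
  have : Real.pi ^ 2 / t ≤ Real.pi ^ 2 / s := by gcongr
  nlinarith [sq_nonneg ((n : ℝ) - z / (2 * Real.pi))]

/-- Monotonicity of √t·theta gives theta(t) ≥ √(s/t)·theta(s), so the negative part of the increment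
is at most (1 - √(s/t))·theta(s). The absolute value is the increment plus twice its negative part.
The right side is linear in theta, so its kernel version can be integrated exactly. -/
lemma abs_theta_sub_le {s t : ℝ} (hs : 0 < s) (hst : s ≤ t) (z : ℝ) :
    |theta t z - theta s z| ≤ theta t z - theta s z + 2 * (1 - √(s / t)) * theta s z := by
  have ht := hs.trans_le hst
  have h1 := sqrt_mul_theta_mono hs hst z
  have h0 := theta_nonneg hs z
  have ht' := Real.sqrt_pos.2 ht
  have hr : √(s / t) * theta s z ≤ theta t z := by
    rw [Real.sqrt_div' _ ht.le, div_mul_eq_mul_div, div_le_iff₀ ht', mul_comm (theta t z)]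
    exact h1
  have hr1 : √(s / t) ≤ 1 := Real.sqrt_le_one.2 ((div_le_one ht).2 hst)
  rw [abs_le]
  constructor <;> nlinarith [mul_nonneg (sub_nonneg.2 hr1) h0]

/-- The Neumann heat kernel on `(0, π)`, a majorant of the Dirichlet heat kernel. -/
def neumannKernel (t x y : ℝ) : ℝ := (2 * Real.pi)⁻¹ * (theta t (x - y) + theta t (x + y))

lemma heatKernel_eq_theta {t : ℝ} (ht : 0 < t) (x y : ℝ) :
    heatKernel t x y = (2 * Real.pi)⁻¹ * (theta t (x - y) - theta t (x + y)) := by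
  have hπ := Real.pi_pos
  unfold heatKernel theta
  rw [add_sub_add_left_eq_sub, ← mul_sub, ← (summable_exp_mul_cos ht (x - y)).tsum_sub
    (summable_exp_mul_cos ht (x + y)), ← tsum_mul_left, ← tsum_mul_left]
  refine tsum_congr fun k => ?_
  have h1 : √(2 / Real.pi) * √(2 / Real.pi) = 2 / Real.pi :=
    Real.mul_self_sqrt (by positivity)
  rw [mul_sub (_ : ℝ) x y, mul_add (_ : ℝ) x y, Real.cos_sub, Real.cos_add, sineMode, sineMode,
    show ∀ a b c d : ℝ, a * (b * c) * (b * d) = a * (b * b) * c * d by intros; ring, h1]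
  field_simp
  ring

lemma abs_heatKernel_le {t : ℝ} (ht : 0 < t) (x y : ℝ) :
    |heatKernel t x y| ≤ neumannKernel t x y := by
  have hπ := Real.pi_pos
  rw [heatKernel_eq_theta ht, abs_mul, abs_of_pos (by positivity), neumannKernel]
  refine mul_le_mul_of_nonneg_left ?_ (by positivity)
  have h1 := theta_nonneg ht (x - y)
  have h2 := theta_nonneg ht (x + y)
  rw [abs_le]
  constructor <;> linarith

/-- The Dirichlet kernel is a difference of two theta values and the Neumann kernel is their sum, so
the triangle inequality turns the scalar increment bound into a bound by Neumann kernels. -/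
lemma abs_heatKernel_sub_le {s t : ℝ} (hs : 0 < s) (hst : s ≤ t) (x y : ℝ) :
    |heatKernel t x y - heatKernel s x y| ≤ neumannKernel t x y - neumannKernel s x y +
      2 * (1 - √(s / t)) * neumannKernel s x y := by
  have hπ := Real.pi_pos
  have ht := hs.trans_le hst
  have h1 := abs_theta_sub_le hs hst (x - y)
  have h2 := abs_theta_sub_le hs hst (x + y)
  rw [heatKernel_eq_theta ht, heatKernel_eq_theta hs, ← mul_sub, abs_mul,
    abs_of_pos (by positivity), neumannKernel, neumannKernel]
  calc _ ≤ (2 * Real.pi)⁻¹ * (|theta t (x - y) - theta s (x - y)| +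
        |theta t (x + y) - theta s (x + y)|) := by
        refine mul_le_mul_of_nonneg_left ?_ (by positivity)
        rw [sub_sub_sub_comm]
        exact abs_sub _ _
    _ ≤ (2 * Real.pi)⁻¹ * ((theta t (x - y) - theta s (x - y) +
        2 * (1 - √(s / t)) * theta s (x - y)) + (theta t (x + y) - theta s (x + y) +
        2 * (1 - √(s / t)) * theta s (x + y))) := by gcongr
    _ = _ := by ring

lemma theta_neg (t z : ℝ) : theta t (-z) = theta t z := by
  simp [theta]

lemma neumannKernel_symm (t x y : ℝ) : neumannKernel t x y = neumannKernel t y x := by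
  rw [neumannKernel, neumannKernel, add_comm x y, ← neg_sub y x, theta_neg]

lemma continuous_theta {t : ℝ} (ht : 0 < t) : Continuous (theta t) := by
  unfold theta
  have h : Continuous fun z : ℝ => ∑' k : ℕ, Real.exp (-((k + 1 : ℕ) : ℝ) ^ 2 * t) *
      Real.cos ((k + 1 : ℕ) * z) := by
    have hc : ∀ k : ℕ, Continuous fun z : ℝ => Real.exp (-((k + 1 : ℕ) : ℝ) ^ 2 * t) *
        Real.cos ((k + 1 : ℕ) * z) := fun k =>
      continuous_const.mul (Real.continuous_cos.comp (continuous_const.mul continuous_id))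
    have hb : ∀ (k : ℕ) (z : ℝ), ‖Real.exp (-((k + 1 : ℕ) : ℝ) ^ 2 * t) *
        Real.cos ((k + 1 : ℕ) * z)‖ ≤ Real.exp (-((k + 1 : ℕ) : ℝ) ^ 2 * t) := fun k z => by
      rw [norm_mul, Real.norm_of_nonneg (Real.exp_pos _).le]
      exact mul_le_of_le_one_right (Real.exp_pos _).le (Real.abs_cos_le_one _)
    exact continuous_tsum hc (summable_exp ht) hb
  exact continuous_const.add (continuous_const.mul h)

lemma continuous_neumannKernel {t : ℝ} (ht : 0 < t) :
    Continuous fun z : ℝ × ℝ => neumannKernel t z.1 z.2 := by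
  have := continuous_theta ht
  unfold neumannKernel
  fun_prop

lemma neumannKernel_nonneg {t : ℝ} (ht : 0 < t) (x y : ℝ) : 0 ≤ neumannKernel t x y :=
  (abs_nonneg _).trans (abs_heatKernel_le ht x y)

lemma integrable_neumannKernel {t : ℝ} (ht : 0 < t) (x : ℝ) :
    Integrable (neumannKernel t x) intervalMeasure := by
  have h : Continuous (neumannKernel t x) := by
    have := continuous_theta ht
    unfold neumannKernel
    fun_prop
  exact (h.continuousOn.integrableOn_Icc (a := 0) (b := Real.pi)).mono_set Ioo_subset_Icc_self

/-- Conservation of mass: in the cosine expansion of the Neumann kernel only the constant mode 1/π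
has a nonzero integral over (0, π). -/
lemma integral_neumannKernel {t : ℝ} (ht : 0 < t) (x : ℝ) :
    ∫ y, neumannKernel t x y ∂intervalMeasure = 1 := by
  have hπ := Real.pi_pos
  set a : ℕ → ℝ := fun k => Real.exp (-((k + 1 : ℕ) : ℝ) ^ 2 * t) with ha
  have e : ∀ y, neumannKernel t x y = Real.pi⁻¹ +
      ∑' k : ℕ, 2 * Real.pi⁻¹ * a k * Real.cos ((k + 1 : ℕ) * x) * Real.cos ((k + 1 : ℕ) * y) := by
    intro y
    have h : neumannKernel t x y = Real.pi⁻¹ + Real.pi⁻¹ *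
        (∑' k : ℕ, (a k * Real.cos ((k + 1 : ℕ) * (x - y)) +
          a k * Real.cos ((k + 1 : ℕ) * (x + y)))) := by
      rw [(summable_exp_mul_cos ht (x - y)).tsum_add (summable_exp_mul_cos ht (x + y))]
      unfold neumannKernel theta
      rw [mul_inv]
      ring
    rw [h, ← tsum_mul_left]
    congr 1
    refine tsum_congr fun k => ?_
    rw [mul_sub (_ : ℝ) x y, mul_add (_ : ℝ) x y, Real.cos_sub, Real.cos_add]
    ring
  have hint : ∀ k, Integrable (fun y => 2 * Real.pi⁻¹ * a k * Real.cos ((k + 1 : ℕ) * x) *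
      Real.cos ((k + 1 : ℕ) * y)) intervalMeasure := fun k => by
    have h : Continuous (fun y => 2 * Real.pi⁻¹ * a k * Real.cos ((k + 1 : ℕ) * x) *
      Real.cos ((k + 1 : ℕ) * y)) := by fun_prop
    exact (h.continuousOn.integrableOn_Icc (a := 0) (b := Real.pi)).mono_set Ioo_subset_Icc_self
  have key := hasSum_integral_of_summable_integral_norm hint ?_
  · have h0 : ∀ k : ℕ, ∫ y, 2 * Real.pi⁻¹ * a k * Real.cos ((k + 1 : ℕ) * x) *
        Real.cos ((k + 1 : ℕ) * y) ∂intervalMeasure = 0 := fun k => by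
      rw [integral_const_mul, ← integral_Ioc_eq_integral_Ioo,
        ← intervalIntegral.integral_of_le hπ.le]
      have hk : ((k + 1 : ℕ) : ℝ) ≠ 0 := by positivity
      rw [intervalIntegral.integral_comp_mul_left (fun x => Real.cos x) hk, integral_cos,
        Real.sin_nat_mul_pi]
      simp
    simp only [h0] at key
    have hz := key.unique hasSum_zero
    have hi : Integrable (fun y => ∑' k : ℕ, 2 * Real.pi⁻¹ * a k * Real.cos ((k + 1 : ℕ) * x) *
        Real.cos ((k + 1 : ℕ) * y)) intervalMeasure := by
      refine ((integrable_neumannKernel ht x).sub (integrable_const (Real.pi⁻¹))).congr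
        (Eventually.of_forall fun y => ?_)
      simp only [Pi.sub_apply, e, add_sub_cancel_left]
    simp only [e]
    rw [integral_add (integrable_const _) hi, hz]
    simp [hπ.le, hπ.ne']
  · refine Summable.of_nonneg_of_le (fun k => integral_nonneg fun y => norm_nonneg _)
      (fun k => ?_) ((summable_exp ht).mul_right (∫ _, 2 * Real.pi⁻¹ ∂intervalMeasure))
    rw [← integral_const_mul]
    refine integral_mono (hint k).norm (integrable_const _) fun y => ?_
    simp only [norm_mul, Real.norm_eq_abs]
    have h1 := Real.abs_cos_le_one ((k + 1 : ℕ) * x)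
    have h2 := Real.abs_cos_le_one ((k + 1 : ℕ) * y)
    have h3 : |a k| = a k := Real.abs_exp _
    rw [h3, abs_of_pos (inv_pos.2 hπ), abs_two]
    calc _ ≤ 2 * Real.pi⁻¹ * a k * 1 * 1 := by
          have : 0 ≤ a k := (Real.exp_pos _).le
          gcongr
      _ = _ := by simp only [ha]; ring

end DirichletHeat

/-! ### Schur's test -/

/-- For fixed x, Hölder's inequality for the measure k(x,·)μ, of mass at most c, moves the power q
inside at the cost of c^(q-1). Tonelli and the bound on the other marginal supply the last factor c.
-/
lemma lintegral_rpow_lintegral_mul_le {α : Type*} [MeasurableSpace α] {μ : Measure α} [SFinite μ]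
    {k : α → α → ℝ≥0∞} (hk : Measurable (Function.uncurry k)) {c : ℝ≥0∞}
    (h1 : ∀ x, ∫⁻ y, k x y ∂μ ≤ c) (h2 : ∀ y, ∫⁻ x, k x y ∂μ ≤ c)
    {f : α → ℝ} (hf : AEStronglyMeasurable f μ) {q : ℝ} (hq : 1 ≤ q) :
    ∫⁻ x, (∫⁻ y, k x y * ‖f y‖ₑ ∂μ) ^ q ∂μ ≤ c ^ q * ∫⁻ y, ‖f y‖ₑ ^ q ∂μ := by
  have hq0 : 0 < q := one_pos.trans_le hq
  have hkx : ∀ x, Measurable (k x) := fun x => hk.comp measurable_prodMk_left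
  have hky : ∀ y, Measurable fun x => k x y := fun y => hk.comp measurable_prodMk_right
  have hfe : AEMeasurable (fun y => ‖f y‖ₑ) μ := hf.enorm
  have key : ∀ x, (∫⁻ y, k x y * ‖f y‖ₑ ∂μ) ^ q ≤
      c ^ (q - 1) * ∫⁻ y, k x y * ‖f y‖ₑ ^ q ∂μ := fun x => by
    set ν := μ.withDensity (k x) with hν
    have hfν : AEStronglyMeasurable f ν := hf.mono_ac (withDensity_absolutelyContinuous _ _)
    have e := eLpNorm'_le_eLpNorm'_mul_rpow_measure_univ one_pos hq hfν
    have e1 : eLpNorm' f 1 ν = ∫⁻ y, k x y * ‖f y‖ₑ ∂μ := by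
      rw [eLpNorm'_eq_lintegral_enorm, hν,
        lintegral_withDensity_eq_lintegral_mul₀ (hkx x).aemeasurable (hfe.pow_const _)]
      simp
    have e2 : eLpNorm' f q ν ^ q = ∫⁻ y, k x y * ‖f y‖ₑ ^ q ∂μ := by
      rw [eLpNorm'_eq_lintegral_enorm, hν,
        lintegral_withDensity_eq_lintegral_mul₀ (hkx x).aemeasurable (hfe.pow_const _),
        ← ENNReal.rpow_mul, one_div, inv_mul_cancel₀ hq0.ne', ENNReal.rpow_one]
      rfl
    have e3 : ν univ ≤ c := by
      rw [hν, withDensity_apply _ MeasurableSet.univ, setLIntegral_univ]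
      exact h1 x
    rw [← e1]
    calc _ ≤ (eLpNorm' f q ν * ν univ ^ (1 / 1 - 1 / q)) ^ q := by gcongr
      _ = ν univ ^ (q - 1) * eLpNorm' f q ν ^ q := by
          rw [ENNReal.mul_rpow_of_nonneg _ _ hq0.le, ← ENNReal.rpow_mul, mul_comm]
          congr 2
          field_simp
      _ ≤ _ := by
          rw [e2]
          gcongr
  calc _ ≤ ∫⁻ x, c ^ (q - 1) * ∫⁻ y, k x y * ‖f y‖ₑ ^ q ∂μ ∂μ := lintegral_mono key
    _ ≤ c ^ (q - 1) * ∫⁻ x, ∫⁻ y, k x y * ‖f y‖ₑ ^ q ∂μ ∂μ := by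
        have hm : AEMeasurable (Function.uncurry fun x y => k x y * ‖f y‖ₑ ^ q) (μ.prod μ) :=
          hk.aemeasurable.mul ((hfe.pow_const q).comp_snd)
        exact (lintegral_const_mul'' _ hm.lintegral_prod_right').le
    _ = c ^ (q - 1) * ∫⁻ y, (∫⁻ x, k x y ∂μ) * ‖f y‖ₑ ^ q ∂μ := by
        have hm : AEMeasurable (Function.uncurry fun x y => k x y * ‖f y‖ₑ ^ q) (μ.prod μ) :=
          hk.aemeasurable.mul ((hfe.pow_const q).comp_snd)
        rw [lintegral_lintegral_swap hm]
        congr 1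
        exact lintegral_congr fun y => lintegral_mul_const _ (hky y)
    _ ≤ c ^ (q - 1) * ∫⁻ y, c * ‖f y‖ₑ ^ q ∂μ := by
        gcongr with y
        exact h2 y
    _ = c ^ q * ∫⁻ y, ‖f y‖ₑ ^ q ∂μ := by
        rw [lintegral_const_mul'' _ (hfe.pow_const q), ← mul_assoc]
        congr 1
        nth_rewrite 2 [← ENNReal.rpow_one c]
        rw [← ENNReal.rpow_add_of_nonneg _ _ (by linarith) zero_le_one, sub_add_cancel]

/-! ### Contractivity and time increments of the heat semigroup on L_p -/

namespace DirichletHeat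

variable {p : ℝ≥0∞} [hp : Fact (1 ≤ p)]

/-- Schur's test for a symmetric nonnegative majorant, one marginal serving for both. The constant
is the mass c of the majorant and does not depend on p. -/
lemma norm_le_of_kernel_bound (hp' : p ≠ ∞) {f g : LpI p} {H : ℝ → ℝ → ℝ}
    (hH : Continuous fun z : ℝ × ℝ => H z.1 z.2) (hsymm : ∀ x y, H x y = H y x)
    (h0 : ∀ x y, 0 ≤ H x y) {c : ℝ} (hint : ∀ x, Integrable (H x) intervalMeasure)
    (hc : ∀ x, ∫ y, H x y ∂intervalMeasure = c)
    (hg : ∀ᵐ x ∂intervalMeasure, ‖(g : ℝ → ℝ) x‖ₑ ≤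
      ∫⁻ y, ENNReal.ofReal (H x y) * ‖(f : ℝ → ℝ) y‖ₑ ∂intervalMeasure) :
    ‖g‖ ≤ c * ‖f‖ := by
  have hp0 : p ≠ 0 := (one_pos.trans_le hp.out).ne'
  have hq : 1 ≤ p.toReal := by
    simpa using ENNReal.toReal_mono hp' hp.out
  have hq0 : 0 < p.toReal := one_pos.trans_le hq
  have hc0 : 0 ≤ c := by
    rw [← hc 0]
    exact integral_nonneg fun y => h0 0 y
  have hi : ∀ x, ∫⁻ y, ENNReal.ofReal (H x y) ∂intervalMeasure ≤ ENNReal.ofReal c := fun x => by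
    rw [← hc x, ofReal_integral_eq_lintegral_ofReal (hint x) (Eventually.of_forall (h0 x))]
  have key := lintegral_rpow_lintegral_mul_le (μ := intervalMeasure)
    (k := fun x y => ENNReal.ofReal (H x y)) (ENNReal.measurable_ofReal.comp hH.measurable) hi
    (fun y => by simpa only [hsymm _ y] using hi y) (Lp.aestronglyMeasurable f) hq
  have h2 : eLpNorm g p intervalMeasure ≤ ENNReal.ofReal c * eLpNorm f p intervalMeasure := by
    rw [eLpNorm_eq_lintegral_rpow_enorm_toReal hp0 hp',
      eLpNorm_eq_lintegral_rpow_enorm_toReal hp0 hp', one_div,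
      ENNReal.rpow_inv_le_iff hq0, ENNReal.mul_rpow_of_nonneg _ _ hq0.le, ← ENNReal.rpow_mul,
      inv_mul_cancel₀ hq0.ne', ENNReal.rpow_one]
    refine le_trans (lintegral_mono_ae (hg.mono fun x hx => ?_)) key
    gcongr
  rw [Lp.norm_def, Lp.norm_def, ← ENNReal.toReal_ofReal hc0, ← ENNReal.toReal_mul]
  exact ENNReal.toReal_mono (ENNReal.mul_ne_top ENNReal.ofReal_ne_top (Lp.eLpNorm_ne_top f)) h2

lemma heatFun_eq (t : ℝ) (h : ℝ → ℝ) (x : ℝ) :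
    heatFun t h x = ∫ y, heatKernel t x y * h y ∂intervalMeasure := by
  rw [heatFun, intervalIntegral.integral_of_le Real.pi_pos.le, integral_Ioc_eq_integral_Ioo]

lemma theta_le {t : ℝ} (ht : 0 < t) (z : ℝ) : theta t z ≤ theta t 0 := by
  unfold theta
  gcongr with k
  · exact summable_exp_mul_cos ht z
  · exact summable_exp_mul_cos ht 0
  · simpa using Real.cos_le_one _

lemma integrable_heatKernel_mul {t : ℝ} (ht : 0 < t) (x : ℝ) (f : LpI p) :
    Integrable (fun y => heatKernel t x y * (f : ℝ → ℝ) y) intervalMeasure := by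
  have hc : Continuous (heatKernel t x) := by
    have h1 := continuous_theta ht
    have h2 : heatKernel t x = fun y => (2 * Real.pi)⁻¹ * (theta t (x - y) - theta t (x + y)) :=
      funext fun y => heatKernel_eq_theta ht x y
    rw [h2]
    fun_prop
  refine (integrable_coe f).bdd_mul (c := (2 * Real.pi)⁻¹ * (theta t 0 + theta t 0))
    hc.aestronglyMeasurable (Eventually.of_forall fun y => ?_)
  refine (abs_heatKernel_le ht x y).trans ?_
  have hπ := Real.pi_pos
  unfold neumannKernel
  gcongr <;> exact theta_le ht _

/-- The heat semigroup is contractive on `L_p(0, π)`. -/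
lemma norm_heat_le (hp' : p ≠ ∞) (t : ℝ) (f : LpI p) : ‖heat t f‖ ≤ ‖f‖ := by
  by_cases ht : 0 < t
  · rw [← one_mul ‖f‖]
    refine norm_le_of_kernel_bound hp' (continuous_neumannKernel ht) (neumannKernel_symm t)
      (neumannKernel_nonneg ht) (integrable_neumannKernel ht) (integral_neumannKernel ht) ?_
    filter_upwards [coeFn_heat ht f] with x hx
    rw [hx, heatFun_eq]
    refine (enorm_integral_le_lintegral_enorm _).trans (lintegral_mono fun y => ?_)
    rw [enorm_mul, Real.enorm_eq_ofReal_abs (heatKernel t x y)]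
    gcongr
    exact abs_heatKernel_le ht x y
  · simp [heat, ht]

/-- The majorant of the kernel increment has mass 1 - 1 + 2(1 - √(s/t)), since both Neumann kernels
have mass one. -/
lemma norm_heat_sub_heat_le (hp' : p ≠ ∞) {s t : ℝ} (hs : 0 < s) (hst : s ≤ t) (f : LpI p) :
    ‖heat t f - heat s f‖ ≤ 2 * (1 - √(s / t)) * ‖f‖ := by
  have ht := hs.trans_le hst
  set a := 2 * (1 - √(s / t)) with ha
  refine norm_le_of_kernel_bound hp' (H := fun x y => neumannKernel t x y - neumannKernel s x y +
      a * neumannKernel s x y) ?_ ?_ ?_ ?_ ?_ ?_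
  · exact ((continuous_neumannKernel ht).sub (continuous_neumannKernel hs)).add
      (continuous_const.mul (continuous_neumannKernel hs))
  · intro x y
    simp only [neumannKernel_symm _ x y]
  · exact fun x y => (abs_nonneg _).trans (abs_heatKernel_sub_le hs hst x y)
  · exact fun x => ((integrable_neumannKernel ht x).sub (integrable_neumannKernel hs x)).add
      ((integrable_neumannKernel hs x).const_mul a)
  · intro x
    have e := integral_add ((integrable_neumannKernel ht x).sub (integrable_neumannKernel hs x))
      ((integrable_neumannKernel hs x).const_mul a)
    simp only [Pi.sub_apply] at e
    rw [e, integral_const_mul, integral_sub (integrable_neumannKernel ht x) (integrable_neumannKernel hs x),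
      integral_neumannKernel ht, integral_neumannKernel hs]
    ring
  · filter_upwards [coeFn_heat ht f, coeFn_heat hs f, Lp.coeFn_sub (heat t f) (heat s f)]
      with x h1 h2 h3
    rw [h3, Pi.sub_apply, h1, h2, heatFun_eq, heatFun_eq,
      ← integral_sub (integrable_heatKernel_mul ht x f) (integrable_heatKernel_mul hs x f)]
    refine (enorm_integral_le_lintegral_enorm _).trans (lintegral_mono fun y => ?_)
    rw [← sub_mul, enorm_mul, Real.enorm_eq_ofReal_abs (heatKernel t x y - heatKernel s x y)]
    gcongr
    exact abs_heatKernel_sub_le hs hst x y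

/-- This takes the place of analyticity of the semigroup: it bounds ‖(e^{rΔ} - I)e^{τΔ}‖ linearly in
r for small r and by a constant for large r, which is all that the fractional powers require. -/
lemma norm_heat_add_sub_heat_le (hp' : p ≠ ∞) {τ r : ℝ} (hτ : 0 < τ) (hr : 0 < r) (f : LpI p) :
    ‖heat (r + τ) f - heat τ f‖ ≤ 2 * ‖f‖ * min 1 (r / τ) := by
  refine (norm_heat_sub_heat_le hp' hτ (by linarith) f).trans ?_
  rw [mul_assoc, mul_assoc, mul_comm ‖f‖]
  refine mul_le_mul_of_nonneg_left (mul_le_mul_of_nonneg_right (le_min ?_ ?_) (norm_nonneg _))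
    two_pos.le
  · linarith [Real.sqrt_nonneg (τ / (r + τ))]
  · have h1 : τ / (r + τ) ≤ √(τ / (r + τ)) := by
      refine Real.le_sqrt_of_sq_le ?_
      have h2 : τ / (r + τ) ≤ 1 := (div_le_one (by linarith)).2 (by linarith)
      have h3 : 0 ≤ τ / (r + τ) := by positivity
      nlinarith
    have h2 : 1 - τ / (r + τ) = r / (r + τ) := by field_simp; ring
    have h3 : r / (r + τ) ≤ r / τ := by gcongr; linarith
    linarith

lemma eq_of_sineCoeffL_eq {f g : LpI p} (h : ∀ k, sineCoeffL k f = sineCoeffL k g) : f = g :=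
  sub_eq_zero.1 (eq_zero_of_sineCoeffL_eq_zero fun k => by rw [map_sub, h, sub_self])

lemma heat_heat {t s : ℝ} (ht : 0 < t) (hs : 0 < s) (f : LpI p) :
    heat t (heat s f) = heat (t + s) f :=
  eq_of_sineCoeffL_eq fun k => by
    rw [sineCoeffL_heat ht, sineCoeffL_heat hs, sineCoeffL_heat (add_pos ht hs), ← mul_assoc,
      ← Real.exp_add]
    congr 2
    ring

lemma exists_heatL (hp' : p ≠ ∞) (t : ℝ) : ∃ A : LpI p →L[ℝ] LpI p, ∀ f, A f = heat t f :=
  ⟨LinearMap.mkContinuous ⟨⟨heat t, heat_add t⟩, fun c f => heat_smul t c f⟩ 1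
    fun f => by simpa using norm_heat_le hp' t f, fun _ => rfl⟩

end DirichletHeat

/-! ### Integrals with the weight t^(-1-a) -/

lemma tendsto_setIntegral_Ioi_zero {E : Type*} [NormedAddCommGroup E] [NormedSpace ℝ E]
    {F : ℝ → E} (hF : IntegrableOn F (Ioi 0)) :
    Tendsto (fun ε : ℝ => ∫ t in Ioi ε, F t) (𝓝[>] 0) (𝓝 (∫ t in Ioi 0, F t)) := by
  have h : Tendsto (fun ε : ℝ => ∫ t in Ioi 0, (Ioi ε).indicator F t) (𝓝[>] 0)
      (𝓝 (∫ t in Ioi 0, F t)) := by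
    refine tendsto_integral_filter_of_dominated_convergence (fun t => ‖F t‖)
      (Eventually.of_forall fun ε => hF.aestronglyMeasurable.indicator measurableSet_Ioi)
      (Eventually.of_forall fun ε => Eventually.of_forall fun t => norm_indicator_le_norm_self _ _)
      hF.norm ?_
    refine (ae_restrict_iff' measurableSet_Ioi).2 (Eventually.of_forall fun t ht => ?_)
    refine tendsto_const_nhds.congr' ?_
    filter_upwards [Ioo_mem_nhdsGT (show (0 : ℝ) < t from ht)] with ε hε
    rw [indicator_of_mem (show t ∈ Ioi ε from hε.2)]
  refine h.congr' ?_
  filter_upwards [self_mem_nhdsWithin] with ε hε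
  rw [setIntegral_indicator measurableSet_Ioi,
    inter_eq_right.2 (Ioi_subset_Ioi (le_of_lt (show (0 : ℝ) < ε from hε)))]

lemma inv_rpow_mul_comp_mul_left {a l : ℝ} (hl : 0 < l) (φ : ℝ → ℝ) {t : ℝ} (ht : 0 < t) :
    (t ^ (1 + a))⁻¹ * φ (l * t) = l ^ (1 + a) * (((l * t) ^ (1 + a))⁻¹ * φ (l * t)) := by
  rw [Real.mul_rpow hl.le ht.le, mul_inv, ← mul_assoc, ← mul_assoc,
    mul_inv_cancel₀ (Real.rpow_pos_of_pos hl _).ne', one_mul]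

lemma integral_inv_rpow_mul_comp_mul_left {a l : ℝ} (hl : 0 < l) (φ : ℝ → ℝ) :
    ∫ t in Ioi (0 : ℝ), (t ^ (1 + a))⁻¹ * φ (l * t) =
      l ^ a * ∫ t in Ioi (0 : ℝ), (t ^ (1 + a))⁻¹ * φ t := by
  rw [setIntegral_congr_fun measurableSet_Ioi
    (fun t ht => inv_rpow_mul_comp_mul_left (a := a) hl φ ht), integral_const_mul,
    integral_comp_mul_left_Ioi (fun t => (t ^ (1 + a))⁻¹ * φ t) 0 hl, mul_zero, smul_eq_mul,
    ← mul_assoc, Real.rpow_add hl, Real.rpow_one]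
  congr 1
  field_simp

lemma integrableOn_inv_rpow_mul_comp_mul_left {a l : ℝ} (hl : 0 < l) {φ : ℝ → ℝ}
    (h : IntegrableOn (fun t : ℝ => (t ^ (1 + a))⁻¹ * φ t) (Ioi 0)) :
    IntegrableOn (fun t : ℝ => (t ^ (1 + a))⁻¹ * φ (l * t)) (Ioi 0) := by
  have h1 := (integrableOn_Ioi_comp_mul_left_iff (fun t => (t ^ (1 + a))⁻¹ * φ t) 0 hl).2
    (by rwa [mul_zero])
  exact IntegrableOn.congr_fun (h1.const_mul (l ^ (1 + a)))
    (fun t ht => (inv_rpow_mul_comp_mul_left hl φ ht).symm) measurableSet_Ioi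

/-- The integrand is t^(-a) near zero and t^(-1-a) at infinity; a < 1 settles the first end and a >
0 the second. -/
lemma integrableOn_inv_rpow_mul_min {a : ℝ} (ha : 0 < a) (ha1 : a < 1) :
    IntegrableOn (fun t : ℝ => (t ^ (1 + a))⁻¹ * min 1 t) (Ioi 0) := by
  rw [← Ioc_union_Ioi_eq_Ioi zero_le_one]
  refine IntegrableOn.union ?_ ?_
  · have h1 : IntegrableOn (fun t : ℝ => t ^ (-a)) (Ioc 0 1) :=
      (intervalIntegrable_iff_integrableOn_Ioc_of_le zero_le_one).1
        (intervalIntegral.intervalIntegrable_rpow' (by linarith))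
    refine h1.congr_fun (fun t ht => ?_) measurableSet_Ioc
    rw [min_eq_right ht.2, ← Real.rpow_neg ht.1.le, ← Real.rpow_add_one ht.1.ne']
    refine congrArg (fun b : ℝ => t ^ b) ?_
    ring
  · refine IntegrableOn.congr_fun (integrableOn_Ioi_rpow_of_lt (a := -(1 + a)) (by linarith)
      one_pos) (fun t ht => ?_) measurableSet_Ioi
    have ht' : (1 : ℝ) < t := ht
    rw [min_eq_left ht'.le, mul_one, Real.rpow_neg (by linarith)]

lemma abs_one_sub_exp_neg_le {t : ℝ} (ht : 0 < t) : |1 - Real.exp (-t)| ≤ min 1 t := by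
  have h1 := Real.exp_pos (-t)
  have h2 : Real.exp (-t) ≤ 1 := Real.exp_le_one_iff.2 (by linarith)
  have h3 := Real.add_one_le_exp (-t)
  rw [abs_of_nonneg (by linarith)]
  exact le_min (by linarith) (by linarith)

lemma measurable_inv_rpow (a : ℝ) : Measurable fun t : ℝ => (t ^ a)⁻¹ :=
  (measurable_id.pow_const a).inv

lemma integrableOn_inv_rpow_mul_one_sub_exp {a : ℝ} (ha : 0 < a) (ha1 : a < 1) :
    IntegrableOn (fun t : ℝ => (t ^ (1 + a))⁻¹ * (1 - Real.exp (-t))) (Ioi 0) := by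
  refine Integrable.mono' (integrableOn_inv_rpow_mul_min ha ha1) ?_ ?_
  · exact ((measurable_inv_rpow _).mul (by fun_prop)).aestronglyMeasurable
  · refine (ae_restrict_iff' measurableSet_Ioi).2 (Eventually.of_forall fun t ht => ?_)
    have ht' : (0 : ℝ) < t := ht
    rw [norm_mul, Real.norm_of_nonneg (inv_nonneg.2 (Real.rpow_nonneg ht'.le _))]
    exact mul_le_mul_of_nonneg_left (abs_one_sub_exp_neg_le ht')
      (inv_nonneg.2 (Real.rpow_nonneg ht'.le _))

namespace DirichletHeat

variable {p : ℝ≥0∞} [hp : Fact (1 ≤ p)]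

/-- Measurability of `L_p(0, π)`-valued maps can be tested on the sine coefficients. -/
lemma aestronglyMeasurable_of_sineCoeffL (hp' : p ≠ ∞) {α : Type*} [MeasurableSpace α]
    {μ : Measure α} {F : α → LpI p} (h : ∀ k, AEMeasurable (fun a => sineCoeffL k (F a)) μ) :
    AEStronglyMeasurable F μ := by
  -- Finiteness of p makes L_p separable, hence a Polish space.
  have : Fact (p ≠ ∞) := ⟨hp'⟩
  let _ : MeasurableSpace (LpI p) := borel _
  have : BorelSpace (LpI p) := ⟨rfl⟩
  have hc : Continuous fun (f : LpI p) (k : ℕ) => sineCoeffL k f :=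
    continuous_pi fun k => (sineCoeffL k).continuous
  have hi : Function.Injective fun (f : LpI p) (k : ℕ) => sineCoeffL k f :=
    fun f g hfg => eq_of_sineCoeffL_eq fun k => congrFun hfg k
  have h1 : AEMeasurable ((fun (f : LpI p) (k : ℕ) => sineCoeffL k f) ∘ F) μ :=
    aemeasurable_pi_iff.2 h
  -- Lusin–Souslin: an injective continuous map from a Polish space into the sequence space is a
  -- measurable embedding, so measurability transfers back from the coefficients.
  exact ((hc.measurableEmbedding hi).aemeasurable_comp_iff.1 h1).aestronglyMeasurable

/-! ### The fractional Laplacian in terms of sine coefficients -/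

/-- The number `c` for which `(-Δ)^{σ/2}` multiplies the `k`-th sine coefficient by `c k^σ`. -/
def fracConst (σ : ℝ) : ℝ :=
  -((Real.Gamma (-σ / 2))⁻¹ * ∫ t in Ioi (0 : ℝ), (t ^ (1 + σ / 2))⁻¹ * (1 - Real.exp (-t)))

/-- The value is in fact 1, by the integral for Γ(-a) with 0 < a < 1. Only nonvanishing is needed,
and it follows from positivity of the integrand. -/
lemma fracConst_ne_zero {σ : ℝ} (hσ : 0 < σ) (hσ2 : σ < 2) : fracConst σ ≠ 0 := by
  have hG : Real.Gamma (-σ / 2) ≠ 0 := Real.Gamma_ne_zero fun m hm => by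
    cases m with
    | zero => rw [Nat.cast_zero] at hm; linarith
    | succ m => push_cast at hm; linarith [Nat.cast_nonneg (α := ℝ) m]
  have hpos : ∀ t ∈ Ioi (0 : ℝ), 0 < (t ^ (1 + σ / 2))⁻¹ * (1 - Real.exp (-t)) := fun t ht => by
    have ht' : (0 : ℝ) < t := ht
    refine mul_pos (inv_pos.2 (Real.rpow_pos_of_pos ht' _)) (sub_pos.2 ?_)
    rw [Real.exp_lt_one_iff]
    linarith
  have hI : 0 < ∫ t in Ioi (0 : ℝ), (t ^ (1 + σ / 2))⁻¹ * (1 - Real.exp (-t)) := by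
    rw [setIntegral_pos_iff_support_of_nonneg_ae
      ((ae_restrict_iff' measurableSet_Ioi).2 (Eventually.of_forall fun t ht => (hpos t ht).le))
      (integrableOn_inv_rpow_mul_one_sub_exp (by linarith) (by linarith)),
      inter_eq_right.2 (show Ioi (0 : ℝ) ⊆ Function.support _ from fun t ht => (hpos t ht).ne')]
    simp
  exact neg_ne_zero.2 (mul_ne_zero (inv_ne_zero hG) hI.ne')

/-- A coefficient functional commutes with the truncated integrals and reduces them to scalar ones
for the eigenvalue l = (k+1)². Rescaling time by l produces l^(σ/2) = (k+1)^σ. -/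
lemma IsFracLaplacianLow.sineCoeffL_eq {σ : ℝ} (hσ : 0 < σ) (hσ2 : σ < 2) {f g : LpI p}
    (h : IsFracLaplacianLow σ f g) (k : ℕ) :
    sineCoeffL k g = fracConst σ * ((k + 1 : ℕ) : ℝ) ^ σ * sineCoeffL k f := by
  rw [IsFracLaplacianLow, if_pos hσ] at h
  set l : ℝ := ((k + 1 : ℕ) : ℝ) ^ 2 with hl
  have hl0 : 0 < l := by positivity
  have h1 := ((sineCoeffL (p := p) k).continuous.tendsto g).comp h
  have h2 := integrableOn_inv_rpow_mul_comp_mul_left hl0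
    (integrableOn_inv_rpow_mul_one_sub_exp (a := σ / 2) (by linarith) (by linarith))
  have h3 := (tendsto_setIntegral_Ioi_zero h2).const_mul
    (-((Real.Gamma (-σ / 2))⁻¹ * sineCoeffL k f))
  rw [integral_inv_rpow_mul_comp_mul_left hl0 (fun t => 1 - Real.exp (-t))] at h3
  have h4 : l ^ (σ / 2) = ((k + 1 : ℕ) : ℝ) ^ σ := by
    rw [hl, ← Real.rpow_natCast, ← Real.rpow_mul (by positivity)]
    congr 1
    push_cast
    ring
  rw [h4] at h3
  have h5 := tendsto_nhds_unique h1 (h3.congr' ?_)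
  · rw [h5, fracConst]
    ring
  · filter_upwards [self_mem_nhdsWithin] with ε hε
    have hε' : (0 : ℝ) < ε := hε
    have i1 := integrableOn_truncated hσ hε' f
    simp only [Function.comp]
    rw [map_smul, ← ContinuousLinearMap.integral_comp_comm _ i1, ← integral_const_mul,
      smul_eq_mul, ← integral_const_mul]
    refine setIntegral_congr_fun measurableSet_Ioi fun t ht => ?_
    rw [map_smul, map_sub, sineCoeffL_heat (hε'.trans ht), smul_eq_mul, ← hl, neg_mul l t]
    ring

/-- A constant in the norm bounds of fractional Laplacians. -/
def fracBound (σ : ℝ) : ℝ :=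
  |(Real.Gamma (-σ / 2))⁻¹| * ∫ t in Ioi (0 : ℝ), (t ^ (1 + σ / 2))⁻¹ * min 1 t

lemma fracBound_nonneg (σ : ℝ) : 0 ≤ fracBound σ := by
  refine mul_nonneg (abs_nonneg _) (setIntegral_nonneg measurableSet_Ioi fun t ht => ?_)
  have ht' : (0 : ℝ) < t := ht
  positivity

lemma norm_truncated_integrand_le {σ M τ : ℝ} {w : LpI p}
    (hw : ∀ r, 0 < r → ‖heat r w - w‖ ≤ M * min 1 (r / τ)) {t : ℝ} (ht : 0 < t) :
    ‖(t ^ (1 + σ / 2))⁻¹ • (heat t w - w)‖ ≤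
      M * ((t ^ (1 + σ / 2))⁻¹ * min 1 (τ⁻¹ * t)) := by
  rw [norm_smul, Real.norm_of_nonneg (inv_nonneg.2 (Real.rpow_nonneg ht.le _)),
    mul_left_comm, inv_mul_eq_div τ t]
  exact mul_le_mul_of_nonneg_left (hw t ht) (inv_nonneg.2 (Real.rpow_nonneg ht.le _))

lemma integrableOn_majorant {σ M τ : ℝ} (hσ : 0 < σ) (hσ2 : σ < 2) (hτ : 0 < τ) :
    IntegrableOn (fun t : ℝ => M * ((t ^ (1 + σ / 2))⁻¹ * min 1 (τ⁻¹ * t))) (Ioi 0) :=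
  (integrableOn_inv_rpow_mul_comp_mul_left (inv_pos.2 hτ)
    (integrableOn_inv_rpow_mul_min (a := σ / 2) (by linarith) (by linarith))).const_mul M

lemma integrableOn_fracIntegrand {σ M τ : ℝ} (hσ : 0 < σ) (hσ2 : σ < 2) (hτ : 0 < τ) {w : LpI p}
    (hw : ∀ r, 0 < r → ‖heat r w - w‖ ≤ M * min 1 (r / τ)) :
    IntegrableOn (fun t : ℝ => (t ^ (1 + σ / 2))⁻¹ • (heat t w - w)) (Ioi 0) := by
  refine Integrable.mono' (integrableOn_majorant (M := M) hσ hσ2 hτ) ?_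
    ((ae_restrict_iff' measurableSet_Ioi).2 (Eventually.of_forall fun t ht =>
      norm_truncated_integrand_le hw ht))
  exact (measurable_inv_rpow _).aestronglyMeasurable.smul
    (((continuousOn_heat w).aestronglyMeasurable measurableSet_Ioi).sub
      aestronglyMeasurable_const)

/-- The substitution t = τu extracts τ^(-σ/2). Uniformity in ε lets the same estimate bound the
limit and serve later as a dominating function. -/
lemma norm_truncated_le {σ M τ : ℝ} (hσ : 0 < σ) (hσ2 : σ < 2) (hτ : 0 < τ) {w : LpI p}
    (hw : ∀ r, 0 < r → ‖heat r w - w‖ ≤ M * min 1 (r / τ)) {ε : ℝ} (hε : 0 ≤ ε) :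
    ‖(Real.Gamma (-σ / 2))⁻¹ • ∫ t in Ioi ε, (t ^ (1 + σ / 2))⁻¹ • (heat t w - w)‖ ≤
      fracBound σ * (M * τ ^ (-(σ / 2))) := by
  have hM : 0 ≤ M := by
    have h1 := (norm_nonneg _).trans (hw 1 one_pos)
    exact nonneg_of_mul_nonneg_left h1 (lt_min one_pos (by positivity))
  have hi := integrableOn_majorant (M := M) hσ hσ2 hτ
  have hsub : Ioi ε ⊆ Ioi (0 : ℝ) := Ioi_subset_Ioi hε
  rw [norm_smul, Real.norm_eq_abs, fracBound, mul_assoc]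
  refine mul_le_mul_of_nonneg_left ?_ (abs_nonneg _)
  calc _ ≤ ∫ t in Ioi ε, M * ((t ^ (1 + σ / 2))⁻¹ * min 1 (τ⁻¹ * t)) :=
        norm_integral_le_of_norm_le (hi.mono_set hsub)
          ((ae_restrict_iff' measurableSet_Ioi).2 (Eventually.of_forall fun t ht =>
            norm_truncated_integrand_le hw (hsub ht)))
    _ ≤ ∫ t in Ioi 0, M * ((t ^ (1 + σ / 2))⁻¹ * min 1 (τ⁻¹ * t)) := by
        refine setIntegral_mono_set hi ?_ hsub.eventuallyLE
        refine (ae_restrict_iff' measurableSet_Ioi).2 (Eventually.of_forall fun t ht => ?_)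
        have ht' : (0 : ℝ) < t := ht
        simp only [Pi.zero_apply]
        positivity
    _ = _ := by
        rw [integral_const_mul, integral_inv_rpow_mul_comp_mul_left (inv_pos.2 hτ)
          (fun t => min 1 t), Real.inv_rpow hτ.le, ← Real.rpow_neg hτ.le]
        ring

/-- The decay hypothesis makes the integral absolutely convergent at 0, so the improper integral is
an ordinary Bochner integral over (0, ∞). -/
lemma exists_isFracLaplacianLow {σ M τ : ℝ} (hσ : 0 < σ) (hσ2 : σ < 2) (hτ : 0 < τ) {w : LpI p}
    (hw : ∀ r, 0 < r → ‖heat r w - w‖ ≤ M * min 1 (r / τ)) :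
    ∃ z, IsFracLaplacianLow σ w z ∧ ‖z‖ ≤ fracBound σ * (M * τ ^ (-(σ / 2))) := by
  refine ⟨(Real.Gamma (-σ / 2))⁻¹ • ∫ t in Ioi 0, (t ^ (1 + σ / 2))⁻¹ • (heat t w - w), ?_,
    norm_truncated_le hσ hσ2 hτ hw le_rfl⟩
  rw [IsFracLaplacianLow, if_pos hσ]
  exact (tendsto_setIntegral_Ioi_zero
    (integrableOn_fracIntegrand hσ hσ2 hτ hw)).const_smul _

/-- The truncations of the fractional Laplacian are bounded operators. -/
lemma exists_truncatedL (hp' : p ≠ ∞) {σ ε : ℝ} (hσ : 0 < σ) (hε : 0 < ε) :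
    ∃ J : LpI p →L[ℝ] LpI p, ∀ f, J f = (Real.Gamma (-σ / 2))⁻¹ •
      ∫ t in Ioi ε, (t ^ (1 + σ / 2))⁻¹ • (heat t f - f) := by
  refine ⟨LinearMap.mkContinuous ⟨⟨fun f => (Real.Gamma (-σ / 2))⁻¹ •
      ∫ t in Ioi ε, (t ^ (1 + σ / 2))⁻¹ • (heat t f - f), fun f g => ?_⟩, fun c f => ?_⟩
    (|(Real.Gamma (-σ / 2))⁻¹| * ∫ t in Ioi ε, t ^ (-(1 + σ / 2)) * 2) fun f => ?_, fun _ => rfl⟩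
  · rw [← smul_add, ← integral_add (integrableOn_truncated hσ hε f)
      (integrableOn_truncated hσ hε g)]
    congr 2
    ext1 t
    rw [heat_add, ← smul_add]
    congr 1
    abel
  · simp only [RingHom.id_apply]
    rw [smul_comm c, ← integral_smul c]
    congr 2
    ext1 t
    rw [heat_smul, ← smul_sub, smul_comm]
  · simp only [LinearMap.coe_mk, AddHom.coe_mk]
    rw [norm_smul, mul_assoc, ← integral_mul_const, Real.norm_eq_abs]
    refine mul_le_mul_of_nonneg_left (norm_integral_le_of_norm_le
      (((integrableOn_Ioi_rpow_of_lt (by linarith) hε).mul_const _).mul_const _)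
      ((ae_restrict_iff' measurableSet_Ioi).2 (Eventually.of_forall fun t ht => ?_)))
      (abs_nonneg _)
    have ht' : 0 < t := hε.trans ht
    rw [norm_smul, Real.norm_of_nonneg (inv_nonneg.2 (Real.rpow_nonneg ht'.le _)),
      Real.rpow_neg ht'.le, mul_assoc]
    refine mul_le_mul_of_nonneg_left ?_ (inv_nonneg.2 (Real.rpow_nonneg ht'.le _))
    linarith [norm_sub_le (heat t f) f, norm_heat_le hp' t f]

end DirichletHeat

/-! ### Bochner integrals, limits and sums -/

/-- Bounded operators commute with the integral, after which dominated convergence applies. It is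
used for the truncated fractional Laplacians as ε → 0 and for e^{qΔ} as q → 0. -/
lemma tendsto_clm_integral {α E ι : Type*} [MeasurableSpace α] [NormedAddCommGroup E]
    [NormedSpace ℝ E] [CompleteSpace E] {μ : Measure α} {l : Filter ι} [l.IsCountablyGenerated]
    {S : ι → E →L[ℝ] E} {z y : α → E} {b : α → ℝ} (hz : Integrable z μ) (hb : Integrable b μ)
    (hS : ∀ᶠ i in l, ∀ᵐ s ∂μ, ‖S i (z s)‖ ≤ b s)
    (hlim : ∀ᵐ s ∂μ, Tendsto (fun i => S i (z s)) l (𝓝 (y s))) :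
    Tendsto (fun i => S i (∫ s, z s ∂μ)) l (𝓝 (∫ s, y s ∂μ)) := by
  simp only [← fun i => ContinuousLinearMap.integral_comp_comm (S i) hz]
  exact tendsto_integral_filter_of_dominated_convergence b
    (Eventually.of_forall fun i => ((S i).integrable_comp hz).aestronglyMeasurable) hS hb hlim

/-- The sum of the norms dominates g and has finite integral by Tonelli. Integrability of g itself
is what yields absolute convergence of the time integral. -/
lemma integrable_and_hasSum_integral {α E : Type*} [MeasurableSpace α] [NormedAddCommGroup E]
    [NormedSpace ℝ E] {μ : Measure α} {F : ℕ → α → E} {g : α → E}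
    (hF : ∀ k, Integrable (F k) μ) (hs : Summable fun k => ∫ a, ‖F k a‖ ∂μ)
    (hg : ∀ᵐ a ∂μ, HasSum (fun k => F k a) (g a)) :
    Integrable g μ ∧ HasSum (fun k => ∫ a, F k a ∂μ) (∫ a, g a ∂μ) := by
  refine ⟨⟨?_, ?_⟩, ?_⟩
  · refine aestronglyMeasurable_of_tendsto_ae atTop
      (f := fun n a => ∑ k ∈ Finset.range n, F k a)
      (fun n => ?_) (hg.mono fun a ha => ha.tendsto_sum_nat)
    exact (integrable_finsetSum _ fun k _ => hF k).aestronglyMeasurable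
  · have h1 : ∀ k, ∫⁻ a, ‖F k a‖ₑ ∂μ = ENNReal.ofReal (∫ a, ‖F k a‖ ∂μ) := fun k =>
      (ofReal_integral_norm_eq_lintegral_enorm (hF k)).symm
    calc ∫⁻ a, ‖g a‖ₑ ∂μ ≤ ∫⁻ a, ∑' k, ‖F k a‖ₑ ∂μ := by
          refine lintegral_mono_ae (hg.mono fun a ha => ?_)
          rw [← ha.tsum_eq]
          exact enorm_tsum_le_tsum_enorm
      _ = ∑' k, ENNReal.ofReal (∫ a, ‖F k a‖ ∂μ) := by
          rw [lintegral_tsum fun k => (hF k).aestronglyMeasurable.enorm]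
          exact tsum_congr h1
      _ < ∞ := by
          rw [← ENNReal.ofReal_tsum_of_nonneg
            (fun k => integral_nonneg fun a => norm_nonneg _) hs]
          exact ENNReal.ofReal_lt_top
  · have h := hasSum_integral_of_summable_integral_norm hF hs
    rwa [integral_congr_ae (hg.mono fun a ha => ha.tsum_eq)] at h

lemma integrableOn_sub_rpow {t a : ℝ} (ht : 0 < t) (ha : -1 < a) :
    IntegrableOn (fun s : ℝ => (t - s) ^ a) (Ioo 0 t) := by
  have h := (intervalIntegral.intervalIntegrable_rpow' (a := 0) (b := t) ha).comp_sub_left t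
  rw [sub_zero, sub_self] at h
  exact ((intervalIntegrable_iff_integrableOn_Ioc_of_le ht.le).1 h.symm).mono_set
    Ioo_subset_Ioc_self

lemma integral_sub_rpow {t d : ℝ} (ht : 0 < t) (hd : 0 < d) :
    ∫ s in Ioo 0 t, (t - s) ^ (d - 1) = t ^ d / d := by
  rw [← integral_Ioc_eq_integral_Ioo, ← intervalIntegral.integral_of_le ht.le,
    intervalIntegral.integral_comp_sub_left (fun s => s ^ (d - 1)), sub_self, sub_zero,
    integral_rpow (Or.inl (by linarith)), sub_add_cancel, Real.zero_rpow hd.ne', sub_zero]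

/-! ### Smoothing by the heat semigroup -/

namespace DirichletHeat

variable {p : ℝ≥0∞} [hp : Fact (1 ≤ p)]

/-- A constant in the smoothing estimates of the heat semigroup. -/
def smoothBound (σ : ℝ) : ℝ := 8 * fracBound σ * 2 ^ (σ / 2)

lemma smoothBound_nonneg (σ : ℝ) : 0 ≤ smoothBound σ := by
  have := fracBound_nonneg σ
  unfold smoothBound
  positivity

/-- Smoothing estimates for `z = (-Δ)^{σ/2} e^{τΔ} g`. -/
lemma exists_fracLaplacian_heat (hp' : p ≠ ∞) {σ τ : ℝ} (hσ : 0 < σ) (hσ2 : σ < 2) (hτ : 0 < τ)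
    (g : LpI p) : ∃ z, IsFracLaplacianLow σ (heat τ g) z ∧
      ‖z‖ ≤ smoothBound σ * τ ^ (-(σ / 2)) * ‖g‖ ∧
      ∀ r, 0 < r → ‖heat r z - z‖ ≤ smoothBound σ * τ ^ (-(σ / 2)) * ‖g‖ * min 1 (r / τ) := by
  have hB := fracBound_nonneg σ
  have hw : ∀ τ : ℝ, 0 < τ → ∀ r, 0 < r →
      ‖heat r (heat τ g) - heat τ g‖ ≤ 2 * ‖g‖ * min 1 (r / τ) := fun τ hτ r hr => by
    rw [heat_heat hr hτ]
    exact norm_heat_add_sub_heat_le hp' hτ hr g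
  obtain ⟨z, hz, hz'⟩ := exists_isFracLaplacianLow hσ hσ2 hτ (hw τ hτ)
  -- Half of the time is kept in reserve: z = e^{(τ/2)Δ}v with v = (-Δ)^{σ/2}e^{(τ/2)Δ}g, so the
  -- increment estimate applied to v bounds the increments of z. The three factors 2 in the 8 come
  -- from the increment bounds for v and for e^{(τ/2)Δ}g and from doubling min(1, r/τ); 2^(σ/2)
  -- comes from (τ/2)^(-σ/2).
  obtain ⟨v, hv, hv'⟩ := exists_isFracLaplacianLow hσ hσ2 (half_pos hτ) (hw _ (half_pos hτ))
  have hzv : z = heat (τ / 2) v := eq_of_sineCoeffL_eq fun k => by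
    rw [hz.sineCoeffL_eq hσ hσ2, sineCoeffL_heat hτ, sineCoeffL_heat (half_pos hτ),
      hv.sineCoeffL_eq hσ hσ2, sineCoeffL_heat (half_pos hτ)]
    have : Real.exp (-((k + 1 : ℕ) : ℝ) ^ 2 * τ) = Real.exp (-((k + 1 : ℕ) : ℝ) ^ 2 * (τ / 2)) *
        Real.exp (-((k + 1 : ℕ) : ℝ) ^ 2 * (τ / 2)) := by
      rw [← Real.exp_add]
      congr 1
      ring
    rw [this]
    ring
  have h2 : (τ / 2) ^ (-(σ / 2)) = 2 ^ (σ / 2) * τ ^ (-(σ / 2)) := by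
    rw [Real.div_rpow hτ.le two_pos.le, Real.rpow_neg two_pos.le, div_inv_eq_mul, mul_comm]
  have hτ' : 0 < τ ^ (-(σ / 2)) := Real.rpow_pos_of_pos hτ _
  refine ⟨z, hz, hz'.trans ?_, fun r hr => ?_⟩
  · have h1 : (1 : ℝ) ≤ 2 ^ (σ / 2) := Real.one_le_rpow one_le_two (by linarith)
    calc _ = 2 * fracBound σ * 1 * τ ^ (-(σ / 2)) * ‖g‖ := by ring
      _ ≤ 8 * fracBound σ * 2 ^ (σ / 2) * τ ^ (-(σ / 2)) * ‖g‖ := by gcongr; norm_num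
      _ = _ := rfl
  · rw [hzv, heat_heat hr (half_pos hτ)]
    refine (norm_heat_add_sub_heat_le hp' (half_pos hτ) hr v).trans ?_
    have h3 : min 1 (r / (τ / 2)) ≤ 2 * min 1 (r / τ) := by
      rw [mul_min_of_nonneg _ _ two_pos.le]
      exact min_le_min (by norm_num) (le_of_eq (by field_simp))
    calc _ ≤ 2 * (fracBound σ * (2 * ‖g‖ * (τ / 2) ^ (-(σ / 2)))) * (2 * min 1 (r / τ)) := by
          gcongr
      _ = _ := by rw [h2, smoothBound]; ring

lemma isFracLaplacian_iff_of_lt_two {s : ℝ} (hs2 : s < 2) {f g : LpI p} :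
    IsFracLaplacian s f g ↔ IsFracLaplacianLow s f g := by
  have h : ⌊s / 2⌋₊ = 0 := Nat.floor_eq_zero.2 (by linarith)
  simp [IsFracLaplacian, h, IsNegLaplacianPow]

lemma isFracLaplacian_two_add {s : ℝ} (hs : 0 < s) (hs2 : s < 2) {f h g : LpI p}
    (hf : IsLaplacian f (-h)) (hg : IsFracLaplacianLow s h g) : IsFracLaplacian (2 + s) f g := by
  have e : ⌊(2 + s) / 2⌋₊ = 1 := by
    rw [Nat.floor_eq_iff (by linarith)]
    push_cast
    constructor <;> linarith
  refine ⟨h, ?_, ?_⟩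
  · rw [e]
    exact ⟨-h, hf, (neg_neg h).symm⟩
  · rw [e]
    simpa using hg

lemma HSpace.sineCoeffL_fracLaplacian {s : ℝ} (hs : 0 < s) (hs2 : s < 2) (f : HSpace s p)
    (k : ℕ) : sineCoeffL k (HSpace.fracLaplacian f) =
      fracConst s * ((k + 1 : ℕ) : ℝ) ^ s * sineCoeffL k (HSpace.toLp f) :=
  ((isFracLaplacian_iff_of_lt_two hs2).1 (HSpace.fracLaplacian_spec f)).sineCoeffL_eq hs hs2 k

lemma HSpace.isometry_fracLaplacian {s : ℝ} :
    Isometry (HSpace.fracLaplacian : HSpace s p →ₗ[ℝ] LpI p) :=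
  AddMonoidHomClass.isometry_of_norm _ fun f => (HSpace.norm_def f).symm

/-! ### The solution at a fixed time -/

/-- The `k`-th sine coefficient of the solution at time `t` for the forcing term `f`. -/
def modeConv {s : ℝ} (f : ℝ → HSpace s p) (t : ℝ) (k : ℕ) : ℝ :=
  ∫ r in Ioo 0 t, Real.exp (-((k + 1 : ℕ) : ℝ) ^ 2 * (t - r)) * sineCoeffL k (HSpace.toLp (f r))

/-- The constant of the theorem. -/
def regBound (β γ : ℝ) : ℝ :=
  |(fracConst γ * fracConst (2 - γ))⁻¹| * (fracBound β * smoothBound (2 - γ)) / ((γ - β) / 2)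

/-- The order 2 + β - γ left after using f(s) ∈ H^γ is split into 2 - γ and β, both in (0, 2). Here
z(s) = (-Δ)^{(2-γ)/2}e^{(t-s)Δ}g(s) is a constant multiple of -Δe^{(t-s)Δ}f(s) on coefficients, and
y(s) = (-Δ)^{β/2}z(s). Then h and G are the normalized integrals of z and y. Strong continuity at h
is included because it is needed to show that -h is a Laplacian. -/
lemma exists_integrated_solution (hp' : p ≠ ∞) {β γ : ℝ} (hβ : 0 < β) (hβγ : β < γ)
    (hγ : γ < 1) {f : ℝ → HSpace γ p} {t M : ℝ} (ht : 0 < t)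
    (hf : AEStronglyMeasurable f (volume.restrict (Ioo 0 t)))
    (hM : ∀ᵐ s ∂(volume.restrict (Ioo 0 t)), ‖f s‖ ≤ M) :
    ∃ h G : LpI p, IsFracLaplacianLow β h G ∧
      Tendsto (fun q => heat q h) (𝓝[>] 0) (𝓝 h) ∧
      (∀ k, sineCoeffL k h = ((k + 1 : ℕ) : ℝ) ^ 2 * modeConv f t k) ∧
      ‖G‖ ≤ regBound β γ * t ^ ((γ - β) / 2) * M := by
  have hγ0 : 0 < γ := hβ.trans hβγ
  have hσ : 0 < 2 - γ := by linarith
  have hσ2 : 2 - γ < 2 := by linarith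
  have hβ2 : β < 2 := by linarith
  set σ := 2 - γ with hσdef
  set μ : Measure ℝ := volume.restrict (Ioo 0 t) with hμ
  have hmem : ∀ᵐ s ∂μ, s ∈ Ioo 0 t := ae_restrict_mem measurableSet_Ioo
  set g : ℝ → LpI p := fun s => HSpace.fracLaplacian (f s) with hgdef
  have hgm : AEStronglyMeasurable g μ :=
    HSpace.isometry_fracLaplacian.continuous.comp_aestronglyMeasurable hf
  have hgM : ∀ᵐ s ∂μ, ‖g s‖ ≤ M := hM
  have hA := smoothBound_nonneg σ
  have hB := fracBound_nonneg β
  -- The default 0 for s ≥ t is never seen by the integrals over (0, t). The increment bound on z is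
  -- kept so that a second fractional power can be applied.
  have hz : ∀ s, ∃ z, s < t → IsFracLaplacianLow σ (heat (t - s) (g s)) z ∧
      ‖z‖ ≤ smoothBound σ * (t - s) ^ (-(σ / 2)) * ‖g s‖ ∧
      ∀ r, 0 < r → ‖heat r z - z‖ ≤
        smoothBound σ * (t - s) ^ (-(σ / 2)) * ‖g s‖ * min 1 (r / (t - s)) := fun s => by
    by_cases hs : s < t
    · obtain ⟨z, h⟩ := exists_fracLaplacian_heat hp' hσ hσ2 (sub_pos.2 hs) (g s)
      exact ⟨z, fun _ => h⟩
    · exact ⟨0, fun h => absurd h hs⟩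
  choose z hz using hz
  have hy : ∀ s, ∃ y, s < t → IsFracLaplacianLow β (z s) y ∧
      ‖y‖ ≤ fracBound β * (smoothBound σ * (t - s) ^ (-(σ / 2)) * ‖g s‖ * (t - s) ^ (-(β / 2))) :=
    fun s => by
    by_cases hs : s < t
    · obtain ⟨y, h⟩ := exists_isFracLaplacianLow hβ hβ2 (sub_pos.2 hs) (hz s hs).2.2
      exact ⟨y, fun _ => h⟩
    · exact ⟨0, fun h => absurd h hs⟩
  choose y hy using hy
  have hcz : ∀ k, ∀ s ∈ Ioo 0 t, sineCoeffL k (z s) = fracConst γ * fracConst σ *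
      ((k + 1 : ℕ) : ℝ) ^ 2 * (Real.exp (-((k + 1 : ℕ) : ℝ) ^ 2 * (t - s)) *
        sineCoeffL k (HSpace.toLp (f s))) := fun k s hs => by
    rw [(hz s hs.2).1.sineCoeffL_eq hσ hσ2, sineCoeffL_heat (sub_pos.2 hs.2), hgdef,
      HSpace.sineCoeffL_fracLaplacian hγ0 (by linarith)]
    -- The multipliers of orders 2 - γ and γ combine to that of -Δ.
    have : ((k + 1 : ℕ) : ℝ) ^ 2 = ((k + 1 : ℕ) : ℝ) ^ σ * ((k + 1 : ℕ) : ℝ) ^ γ := by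
      rw [← Real.rpow_add (by positivity), hσdef, sub_add_cancel, Real.rpow_two]
    rw [this]
    ring
  have hcz' : ∀ k, ∀ s ∈ Ioo 0 t, sineCoeffL k (z s) = fracConst σ * ((k + 1 : ℕ) : ℝ) ^ σ *
      (Real.exp (-((k + 1 : ℕ) : ℝ) ^ 2 * (t - s)) * sineCoeffL k (g s)) := fun k s hs => by
    rw [(hz s hs.2).1.sineCoeffL_eq hσ hσ2, sineCoeffL_heat (sub_pos.2 hs.2)]
  have hmode : ∀ k, AEMeasurable (fun s => Real.exp (-((k + 1 : ℕ) : ℝ) ^ 2 * (t - s)) *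
      sineCoeffL k (g s)) μ := fun k => by
    refine AEMeasurable.mul (by fun_prop) ?_
    exact ((sineCoeffL k).continuous.comp_aestronglyMeasurable hgm).aemeasurable
  have hzk : ∀ k, AEMeasurable (fun s => sineCoeffL k (z s)) μ := fun k =>
    ((hmode k).const_mul _).congr (hmem.mono fun s hs => (hcz' k s hs).symm)
  have hzm : AEStronglyMeasurable z μ := aestronglyMeasurable_of_sineCoeffL hp' hzk
  have hym : AEStronglyMeasurable y μ := aestronglyMeasurable_of_sineCoeffL hp' fun k =>
    ((hzk k).const_mul (fracConst β * ((k + 1 : ℕ) : ℝ) ^ β)).congr (hmem.mono fun s hs =>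
      ((hy s hs.2).1.sineCoeffL_eq hβ hβ2 k).symm)
  set b1 : ℝ → ℝ := fun s => smoothBound σ * (t - s) ^ (-(σ / 2)) * M with hb1
  set b2 : ℝ → ℝ := fun s =>
    fracBound β * smoothBound σ * M * (t - s) ^ ((γ - β) / 2 - 1) with hb2
  have hb1i : Integrable b1 μ :=
    ((integrableOn_sub_rpow ht (by linarith)).const_mul _).mul_const _
  have hb2i : Integrable b2 μ := (integrableOn_sub_rpow ht (by linarith)).const_mul _
  have hzb : ∀ᵐ s ∂μ, ‖z s‖ ≤ b1 s := by
    filter_upwards [hmem, hgM] with s hs hgs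
    refine (hz s hs.2).2.1.trans ?_
    have : 0 ≤ t - s := (sub_pos.2 hs.2).le
    simp only [hb1]
    gcongr
  have hyb' : ∀ᵐ s ∂μ, fracBound β * (smoothBound σ * (t - s) ^ (-(σ / 2)) * ‖g s‖ *
      (t - s) ^ (-(β / 2))) ≤ b2 s := by
    filter_upwards [hmem, hgM] with s hs hgs
    have hts : 0 < t - s := sub_pos.2 hs.2
    -- The two singularities have total exponent -(2 - γ)/2 - β/2 = (γ - β)/2 - 1, which exceeds -1
    -- because β < γ.
    have e : (t - s) ^ ((γ - β) / 2 - 1) = (t - s) ^ (-(σ / 2)) * (t - s) ^ (-(β / 2)) := by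
      rw [← Real.rpow_add hts]
      congr 1
      rw [hσdef]
      ring
    simp only [hb2, e]
    calc _ ≤ fracBound β * (smoothBound σ * (t - s) ^ (-(σ / 2)) * M *
      (t - s) ^ (-(β / 2))) := by gcongr
      _ = _ := by ring
  have hyb : ∀ᵐ s ∂μ, ‖y s‖ ≤ b2 s := by
    filter_upwards [hmem, hyb'] with s hs hs'
    exact (hy s hs.2).2.trans hs'
  have hzi : Integrable z μ := Integrable.mono' hb1i hzm hzb
  set c := (fracConst γ * fracConst σ)⁻¹ with hc
  have hc0 : fracConst γ * fracConst σ ≠ 0 :=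
    mul_ne_zero (fracConst_ne_zero hγ0 (by linarith)) (fracConst_ne_zero hσ hσ2)
  refine ⟨c • ∫ s, z s ∂μ, c • ∫ s, y s ∂μ, IsFracLaplacianLow.smul c ?_, ?_, fun k => ?_, ?_⟩
  · rw [IsFracLaplacianLow, if_pos hβ]
    -- The truncations are taken as bounded operators so that they pass through the integral over s;
    -- for ε ≤ 0 the value is immaterial.
    have hJ : ∀ ε : ℝ, ∃ J : LpI p →L[ℝ] LpI p, 0 < ε → ∀ f, J f = (Real.Gamma (-β / 2))⁻¹ •
        ∫ t in Ioi ε, (t ^ (1 + β / 2))⁻¹ • (heat t f - f) := fun ε => by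
      by_cases hε : 0 < ε
      · obtain ⟨J, hJ⟩ := exists_truncatedL (p := p) hp' hβ hε
        exact ⟨J, fun _ => hJ⟩
      · exact ⟨0, fun h => absurd h hε⟩
    choose J hJ using hJ
    have key := tendsto_clm_integral (l := 𝓝[>] (0 : ℝ)) (S := J) (y := y) hzi hb2i ?_ ?_
    · refine key.congr' ?_
      filter_upwards [self_mem_nhdsWithin] with ε hε
      exact hJ ε hε _
    · filter_upwards [self_mem_nhdsWithin] with ε hε
      filter_upwards [hmem, hyb'] with s hs hs'
      rw [hJ ε hε]
      exact (norm_truncated_le hβ hβ2 (sub_pos.2 hs.2) (hz s hs.2).2.2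
        (le_of_lt (show (0 : ℝ) < ε from hε))).trans hs'
    · filter_upwards [hmem] with s hs
      have h1 := (hy s hs.2).1
      rw [IsFracLaplacianLow, if_pos hβ] at h1
      refine h1.congr' ?_
      filter_upwards [self_mem_nhdsWithin] with ε hε
      exact (hJ ε hε _).symm
  -- Each z(s) already satisfies ‖e^{qΔ}z(s) - z(s)‖ ≤ Kq/(t-s), and contractivity dominates, so
  -- e^{qΔ}h → h follows without strong continuity on all of L_p.
  · choose A hA using exists_heatL (p := p) hp'
    have key := tendsto_clm_integral (l := 𝓝[>] (0 : ℝ)) (S := A) (y := z) hzi hb1i ?_ ?_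
    · simp only [heat_smul]
      simp only [hA] at key
      exact key.const_smul c
    · refine Eventually.of_forall fun q => hzb.mono fun s hs => ?_
      rw [hA]
      exact (norm_heat_le hp' q _).trans hs
    · filter_upwards [hmem] with s hs
      simp only [hA]
      rw [tendsto_iff_norm_sub_tendsto_zero]
      set K := smoothBound σ * (t - s) ^ (-(σ / 2)) * ‖g s‖ with hK
      have hts : 0 < t - s := sub_pos.2 hs.2
      have hK0 : 0 ≤ K := by positivity
      have h0 : Tendsto (fun q : ℝ => K * (q / (t - s))) (𝓝[>] 0) (𝓝 0) := by
        have : Continuous fun q : ℝ => K * (q / (t - s)) := by fun_prop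
        simpa using (this.tendsto 0).mono_left nhdsWithin_le_nhds
      refine squeeze_zero' (Eventually.of_forall fun q => norm_nonneg _) ?_ h0
      filter_upwards [self_mem_nhdsWithin] with q hq
      exact ((hz s hs.2).2.2 q hq).trans (mul_le_mul_of_nonneg_left (min_le_right _ _) hK0)
  · rw [map_smul, ← ContinuousLinearMap.integral_comp_comm _ hzi,
      setIntegral_congr_fun measurableSet_Ioo (hcz k), integral_const_mul, smul_eq_mul, modeConv,
      mul_assoc (fracConst γ * fracConst σ), hc, inv_mul_cancel_left₀ hc0]
  · rw [norm_smul, regBound, Real.norm_eq_abs]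
    have h1 : ‖∫ s, y s ∂μ‖ ≤ fracBound β * smoothBound σ * M *
        (t ^ ((γ - β) / 2) / ((γ - β) / 2)) := by
      refine (norm_integral_le_of_norm_le hb2i hyb).trans (le_of_eq ?_)
      rw [integral_const_mul, integral_sub_rpow ht (by linarith)]
    calc _ ≤ |c| * (fracBound β * smoothBound σ * M *
        (t ^ ((γ - β) / 2) / ((γ - β) / 2))) := by gcongr
      _ = _ := by ring

/-- On coefficients, e^{rΔ}u - u = -∫_0^r e^{qΔ}h dq. Divided by r, the right side is an average
that tends to -h by continuity at q = 0. -/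
lemma isLaplacian_of_sineCoeffL (hp' : p ≠ ∞) {u h : LpI p}
    (hu : ∀ k, sineCoeffL k h = ((k + 1 : ℕ) : ℝ) ^ 2 * sineCoeffL k u)
    (hh : Tendsto (fun q => heat q h) (𝓝[>] 0) (𝓝 h)) : IsLaplacian u (-h) := by
  have hint : ∀ r, IntegrableOn (fun q => heat q h) (Ioc 0 r) := fun r => by
    refine Integrable.mono' (g := fun _ => ‖h‖) (integrable_const _) ?_
      (Eventually.of_forall fun q => norm_heat_le hp' q h)
    exact ((continuousOn_heat h).mono fun q hq => hq.1).aestronglyMeasurable measurableSet_Ioc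
  have key : ∀ r : ℝ, 0 < r → heat r u - u = -∫ q in (0 : ℝ)..r, heat q h := fun r hr => by
    refine eq_of_sineCoeffL_eq fun k => ?_
    have hk : -((k + 1 : ℕ) : ℝ) ^ 2 ≠ 0 := neg_ne_zero.2 (by positivity)
    rw [map_sub, map_neg, sineCoeffL_heat hr, intervalIntegral.integral_of_le hr.le,
      ← ContinuousLinearMap.integral_comp_comm _ (hint r),
      setIntegral_congr_fun measurableSet_Ioc (fun q hq => sineCoeffL_heat hq.1 k h),
      integral_mul_const, ← intervalIntegral.integral_of_le hr.le,
      intervalIntegral.integral_comp_mul_left (fun x => Real.exp x) hk, integral_exp, mul_zero,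
      Real.exp_zero, hu, smul_eq_mul]
    field_simp
  rw [IsLaplacian, Metric.tendsto_nhdsWithin_nhds]
  intro ε hε
  obtain ⟨δ, hδ, hδ'⟩ := Metric.tendsto_nhdsWithin_nhds.1 hh (ε / 2) (half_pos hε)
  refine ⟨δ, hδ, fun {r} hr hrδ => ?_⟩
  have hr0 : (0 : ℝ) < r := hr
  rw [Real.dist_eq, sub_zero, abs_of_pos hr0] at hrδ
  have hi : IntervalIntegrable (fun q => heat q h) volume 0 r :=
    (intervalIntegrable_iff_integrableOn_Ioc_of_le hr0.le).2 (hint r)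
  have e1 : r⁻¹ • (heat r u - u) - -h = -(r⁻¹ • ∫ q in (0 : ℝ)..r, (heat q h - h)) := by
    rw [intervalIntegral.integral_sub hi (by simp), intervalIntegral.integral_const, sub_zero,
      key r hr0, smul_sub, smul_smul, inv_mul_cancel₀ hr0.ne', one_smul, smul_neg]
    abel
  rw [dist_eq_norm, e1, norm_neg, norm_smul, Real.norm_of_nonneg (inv_nonneg.2 hr0.le)]
  have h1 : ‖∫ q in (0 : ℝ)..r, (heat q h - h)‖ ≤ ε / 2 * |r - 0| := by
    refine intervalIntegral.norm_integral_le_of_norm_le_const fun q hq => ?_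
    rw [uIoc_of_le hr0.le] at hq
    have := hδ' (x := q) hq.1 (by
      rw [Real.dist_eq, sub_zero, abs_of_pos hq.1]
      exact hq.2.trans_lt hrδ)
    rw [dist_eq_norm] at this
    exact this.le
  rw [sub_zero, abs_of_pos hr0] at h1
  calc _ ≤ r⁻¹ * (ε / 2 * r) := by gcongr
    _ = ε / 2 := by field_simp
    _ < ε := half_lt_self hε

/-- For each f the coefficients are bounded by a multiple of its L_1 norm, so Banach–Steinhaus
applies. The bound B may depend on p: it enters only qualitative convergence statements, not the
final constant. -/
lemma exists_abs_sineCoeffL_le : ∃ B : ℝ, ∀ (k : ℕ) (f : LpI p), |sineCoeffL k f| ≤ B * ‖f‖ := by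
  obtain ⟨B, hB⟩ := banach_steinhaus (g := fun k => sineCoeffL (p := p) k) fun f =>
    ⟨_, fun k => abs_sineCoeff_le k (integrable_coe f)⟩
  exact ⟨B, fun k f => ((sineCoeffL k).le_opNorm f).trans (by gcongr; exact hB k)⟩

/-! ### Sine series and the space-time convolution -/

/-- Sine series with absolutely summable coefficients. -/
lemma exists_sineSeries (p : ℝ≥0∞) [Fact (1 ≤ p)] {a : ℕ → ℝ} (ha : Summable fun k => |a k|) :
    ∃ u : LpI p, (u =ᵐ[intervalMeasure] fun x => ∑' k, a k * sineMode (k + 1) x) ∧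
      ∀ k, sineCoeffL k u = a k := by
  have hb : ∀ k x, ‖a k * sineMode (k + 1) x‖ ≤ |a k| * √(2 / Real.pi) := fun k x => by
    rw [norm_mul]
    exact mul_le_mul_of_nonneg_left (abs_sineMode_le _ x) (abs_nonneg _)
  have hc : Continuous fun x => ∑' k, a k * sineMode (k + 1) x :=
    continuous_tsum (fun k => continuous_const.mul (continuous_sineMode _)) (ha.mul_right _) hb
  have hm : MemLp (fun x => ∑' k, a k * sineMode (k + 1) x) p intervalMeasure :=
    MemLp.of_bound hc.aestronglyMeasurable (∑' k, |a k| * √(2 / Real.pi))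
      (Eventually.of_forall fun x => tsum_of_norm_bounded (ha.mul_right _).hasSum fun k => hb k x)
  refine ⟨hm.toLp, hm.coeFn_toLp, fun k => ?_⟩
  rw [sineCoeffL_apply, sineCoeff_congr k hm.coeFn_toLp, sineCoeff]
  have hi : ∀ j, Integrable (fun x => sineMode (k + 1) x * (a j * sineMode (j + 1) x))
      intervalMeasure := fun j => by
    refine integrable_sineMode_mul _ (Integrable.const_mul ?_ _)
    simpa using integrable_sineMode_mul (j + 1) (integrable_const (μ := intervalMeasure) (1 : ℝ))
  have h := (integrable_and_hasSum_integral hi ?_ (g := fun x => sineMode (k + 1) x *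
    ∑' j, a j * sineMode (j + 1) x) (Eventually.of_forall fun x =>
      (Summable.of_norm_bounded (ha.mul_right _) fun j => hb j x).hasSum.mul_left _)).2
  · refine h.unique ?_
    have e : ∀ j, ∫ x, sineMode (k + 1) x * (a j * sineMode (j + 1) x) ∂intervalMeasure =
        if j = k then a k else 0 := fun j => by
      simp only [mul_left_comm (sineMode (k + 1) _) (a j)]
      rw [integral_const_mul, integral_sineMode_mul]
      by_cases h : j = k
      · simp [h]
      · simp [h, Ne.symm h]
    simp only [e]
    exact hasSum_ite_eq k _
  · refine Summable.of_nonneg_of_le (fun j => integral_nonneg fun y => norm_nonneg _)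
      (fun j => ?_) (ha.mul_right (∫ _, √(2 / Real.pi) * √(2 / Real.pi) ∂intervalMeasure))
    rw [← integral_const_mul]
    refine integral_mono (hi j).norm (integrable_const _) fun x => ?_
    simp only [norm_mul, Real.norm_eq_abs]
    calc |sineMode (k + 1) x| * (|a j| * |sineMode (j + 1) x|) ≤
        √(2 / Real.pi) * (|a j| * √(2 / Real.pi)) := by
          gcongr
          · exact abs_sineMode_le _ _
          · exact abs_sineMode_le _ _
      _ = _ := by ring

/-- The sine coefficients are uniformly bounded on `H^γ_p`. -/
lemma HSpace.exists_abs_sineCoeffL_toLp_le {γ : ℝ} (hγ0 : 0 < γ) (hγ2 : γ < 2) :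
    ∃ B : ℝ, 0 ≤ B ∧ ∀ (k : ℕ) (f : HSpace γ p), |sineCoeffL k (HSpace.toLp f)| ≤ B * ‖f‖ := by
  obtain ⟨B, hB⟩ := exists_abs_sineCoeffL_le (p := p)
  refine ⟨|fracConst γ|⁻¹ * max B 0, by positivity, fun k f => ?_⟩
  have h1 := HSpace.sineCoeffL_fracLaplacian hγ0 hγ2 f k
  have h2 := hB k (HSpace.fracLaplacian f)
  have hc := abs_pos.2 (fracConst_ne_zero hγ0 hγ2)
  have h3 : (1 : ℝ) ≤ ((k + 1 : ℕ) : ℝ) ^ γ :=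
    Real.one_le_rpow (by exact_mod_cast Nat.le_add_left 1 k) hγ0.le
  rw [h1, abs_mul, abs_mul, abs_of_pos (one_pos.trans_le h3), ← HSpace.norm_def] at h2
  rw [mul_assoc, le_inv_mul_iff₀ hc]
  calc |fracConst γ| * |sineCoeffL k (HSpace.toLp f)|
      ≤ |fracConst γ| * |sineCoeffL k (HSpace.toLp f)| * ((k + 1 : ℕ) : ℝ) ^ γ :=
        le_mul_of_one_le_right (by positivity) h3
    _ ≤ B * ‖f‖ := by linarith
    _ ≤ max B 0 * ‖f‖ := by gcongr; exact le_max_left _ _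

/-- The topology of H^γ_p is induced by `fracLaplacian`, so the coefficient is rewritten as a
multiple of a coefficient of the fractional Laplacian. -/
lemma HSpace.continuous_sineCoeffL_toLp {γ : ℝ} (hγ0 : 0 < γ) (hγ2 : γ < 2) (k : ℕ) :
    Continuous fun f : HSpace γ p => sineCoeffL k (HSpace.toLp f) := by
  have hc : fracConst γ * ((k + 1 : ℕ) : ℝ) ^ γ ≠ 0 :=
    mul_ne_zero (fracConst_ne_zero hγ0 hγ2) (Real.rpow_pos_of_pos (by positivity) _).ne'
  have h : (fun f : HSpace γ p => sineCoeffL k (HSpace.toLp f)) = fun f =>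
      (fracConst γ * ((k + 1 : ℕ) : ℝ) ^ γ)⁻¹ * sineCoeffL k (HSpace.fracLaplacian f) := by
    funext f
    rw [HSpace.sineCoeffL_fracLaplacian hγ0 hγ2, inv_mul_cancel_left₀ hc]
  rw [h]
  exact continuous_const.mul ((sineCoeffL k).continuous.comp
    HSpace.isometry_fracLaplacian.continuous)

/-- The gain k^(-2) from integrating in time makes the coefficients of the solution absolutely
summable when those of the forcing are merely bounded. -/
lemma integral_exp_mode_le (k : ℕ) {t : ℝ} (ht : 0 < t) :
    ∫ s in Ioo 0 t, Real.exp (-((k + 1 : ℕ) : ℝ) ^ 2 * (t - s)) ≤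
      (((k + 1 : ℕ) : ℝ) ^ 2)⁻¹ := by
  have hk : -((k + 1 : ℕ) : ℝ) ^ 2 ≠ 0 := neg_ne_zero.2 (by positivity)
  rw [← integral_Ioc_eq_integral_Ioo, ← intervalIntegral.integral_of_le ht.le,
    intervalIntegral.integral_comp_sub_left
      (fun s => Real.exp (-((k + 1 : ℕ) : ℝ) ^ 2 * s)), sub_self, sub_zero,
    intervalIntegral.integral_comp_mul_left (fun x => Real.exp x) hk, integral_exp, mul_zero,
    Real.exp_zero, smul_eq_mul, inv_neg, neg_mul, ← mul_neg, neg_sub]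
  refine mul_le_of_le_one_right (by positivity) ?_
  linarith [Real.exp_pos (-((k + 1 : ℕ) : ℝ) ^ 2 * t)]

lemma summable_inv_sq_succ : Summable fun k : ℕ => (((k + 1 : ℕ) : ℝ) ^ 2)⁻¹ :=
  (summable_nat_add_iff 1 (f := fun n : ℕ => ((n : ℝ) ^ 2)⁻¹)).2
    (Real.summable_nat_pow_inv.2 one_lt_two)

/-- The coefficients of the solution are summable, and the sine series represents the space-time
convolution, whose defining integral converges absolutely. -/
lemma modeConv_spec {γ : ℝ} (hγ0 : 0 < γ) (hγ2 : γ < 2) {f : ℝ → HSpace γ p} {t M : ℝ}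
    (ht : 0 < t) (hf : AEStronglyMeasurable f (volume.restrict (Ioo 0 t)))
    (hM : ∀ᵐ s ∂(volume.restrict (Ioo 0 t)), ‖f s‖ ≤ M) :
    (∀ k, IntegrableOn (fun s => Real.exp (-((k + 1 : ℕ) : ℝ) ^ 2 * (t - s)) *
      sineCoeffL k (HSpace.toLp (f s))) (Ioo 0 t)) ∧
    (Summable fun k => |modeConv f t k|) ∧ ∀ x,
      IntervalIntegrable (fun s => heatFun (t - s) (HSpace.toLp (f s)) x) volume 0 t ∧
      HasSum (fun k => modeConv f t k * sineMode (k + 1) x)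
        (∫ s in (0 : ℝ)..t, heatFun (t - s) (HSpace.toLp (f s)) x) := by
  set μ : Measure ℝ := volume.restrict (Ioo 0 t) with hμ
  have hmem : ∀ᵐ s ∂μ, s ∈ Ioo 0 t := ae_restrict_mem measurableSet_Ioo
  obtain ⟨B, hB0, hB⟩ := HSpace.exists_abs_sineCoeffL_toLp_le (p := p) hγ0 hγ2
  have hM0 : 0 ≤ M := by
    -- Since t > 0 the measure is nonzero, so the almost-everywhere bound holds at some point and
    -- forces M ≥ 0.
    have : NeZero μ := ⟨by
      rw [hμ, Ne, Measure.restrict_eq_zero]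
      simp [ht]⟩
    obtain ⟨s, hs⟩ := hM.exists
    exact (norm_nonneg _).trans hs
  have hei : ∀ k : ℕ, Integrable (fun s => Real.exp (-((k + 1 : ℕ) : ℝ) ^ 2 * (t - s))) μ :=
    fun k => by
    have h : Continuous fun s => Real.exp (-((k + 1 : ℕ) : ℝ) ^ 2 * (t - s)) := by fun_prop
    exact (h.continuousOn.integrableOn_Icc (a := 0) (b := t)).mono_set Ioo_subset_Icc_self
  have hbd : ∀ k : ℕ, ∀ᵐ s ∂μ, ‖Real.exp (-((k + 1 : ℕ) : ℝ) ^ 2 * (t - s)) *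
      sineCoeffL k (HSpace.toLp (f s))‖ ≤
        Real.exp (-((k + 1 : ℕ) : ℝ) ^ 2 * (t - s)) * (B * M) := fun k => by
    filter_upwards [hM] with s hs
    rw [norm_mul, Real.norm_of_nonneg (Real.exp_pos _).le, Real.norm_eq_abs]
    gcongr
    exact (hB k _).trans (by gcongr)
  have hi : ∀ k, Integrable (fun s => Real.exp (-((k + 1 : ℕ) : ℝ) ^ 2 * (t - s)) *
      sineCoeffL k (HSpace.toLp (f s))) μ := fun k =>
    Integrable.mono' ((hei k).mul_const _) ((hei k).aestronglyMeasurable.mul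
      ((HSpace.continuous_sineCoeffL_toLp hγ0 hγ2 k).comp_aestronglyMeasurable hf)) (hbd k)
  have hn : ∀ k : ℕ, ∫ s, ‖Real.exp (-((k + 1 : ℕ) : ℝ) ^ 2 * (t - s)) *
      sineCoeffL k (HSpace.toLp (f s))‖ ∂μ ≤ (((k + 1 : ℕ) : ℝ) ^ 2)⁻¹ * (B * M) := fun k => by
    refine (integral_mono_ae (hi k).norm ((hei k).mul_const _) (hbd k)).trans ?_
    rw [integral_mul_const]
    exact mul_le_mul_of_nonneg_right (integral_exp_mode_le k ht) (by positivity)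
  have hsum := summable_inv_sq_succ.mul_right (B * M)
  refine ⟨hi, Summable.of_nonneg_of_le (fun k => abs_nonneg _)
    (fun k => (norm_integral_le_integral_norm _).trans (hn k)) hsum, fun x => ?_⟩
  have key := integrable_and_hasSum_integral (μ := μ)
    (F := fun k s => Real.exp (-((k + 1 : ℕ) : ℝ) ^ 2 * (t - s)) *
      sineCoeffL k (HSpace.toLp (f s)) * sineMode (k + 1) x)
    (g := fun s => heatFun (t - s) (HSpace.toLp (f s)) x) (fun k => (hi k).mul_const _) ?_ ?_
  · rw [intervalIntegrable_iff_integrableOn_Ioo_of_le ht.le,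
      intervalIntegral.integral_of_le ht.le, integral_Ioc_eq_integral_Ioo]
    refine ⟨key.1, ?_⟩
    have h := key.2
    simp only [integral_mul_const] at h
    exact h
  · refine Summable.of_nonneg_of_le (fun k => integral_nonneg fun y => norm_nonneg _)
      (fun k => ?_) (hsum.mul_right √(2 / Real.pi))
    simp only [norm_mul _ (sineMode _ _)]
    rw [integral_mul_const]
    exact mul_le_mul (hn k) (abs_sineMode_le _ _) (norm_nonneg _) (by positivity)
  · filter_upwards [hmem] with s hs
    simp only [mul_assoc]
    exact hasSum_heatFun (sub_pos.2 hs.2) (integrable_coe _) x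

lemma HSpace.eq_of_sineCoeffL_eq {s : ℝ} {u v : HSpace s p}
    (h : ∀ k, sineCoeffL k (HSpace.toLp u) = sineCoeffL k (HSpace.toLp v)) : u = v :=
  Subtype.ext (DirichletHeat.eq_of_sineCoeffL_eq h)

/-- Maximal regularity at a fixed time. -/
lemma exists_solution (hp' : p ≠ ∞) {β γ : ℝ} (hβ : 0 < β) (hβγ : β < γ) (hγ : γ < 1)
    {f : ℝ → HSpace γ p} {t M : ℝ} (ht : 0 < t)
    (hf : AEStronglyMeasurable f (volume.restrict (Ioo 0 t)))
    (hM : ∀ᵐ s ∂(volume.restrict (Ioo 0 t)), ‖f s‖ ≤ M) :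
    ∃ v : HSpace (2 + β) p, (∀ k, sineCoeffL k (HSpace.toLp v) = modeConv f t k) ∧
      (∀ k, sineCoeffL k (HSpace.fracLaplacian v) =
        fracConst β * ((k + 1 : ℕ) : ℝ) ^ β * ((k + 1 : ℕ) : ℝ) ^ 2 * modeConv f t k) ∧
      (HSpace.toLp v =ᵐ[intervalMeasure] fun x =>
        ∫ s in (0 : ℝ)..t, heatFun (t - s) (HSpace.toLp (f s)) x) ∧
      ‖v‖ ≤ regBound β γ * t ^ ((γ - β) / 2) * M := by
  obtain ⟨h, G, hG, hh, hk, hn⟩ := exists_integrated_solution hp' hβ hβγ hγ ht hf hM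
  obtain ⟨-, hs, hx⟩ := modeConv_spec (hβ.trans hβγ) (by linarith) ht hf hM
  obtain ⟨u, hu, huk⟩ := exists_sineSeries p hs
  have hlap : IsLaplacian u (-h) :=
    isLaplacian_of_sineCoeffL hp' (fun k => by rw [hk, huk]) hh
  have hfrac : IsFracLaplacian (2 + β) u G :=
    isFracLaplacian_two_add hβ (by linarith) hlap hG
  obtain ⟨v, rfl⟩ : ∃ v : HSpace (2 + β) p, HSpace.toLp v = u := ⟨⟨u, G, hfrac⟩, rfl⟩
  have hv : HSpace.fracLaplacian v = G := (HSpace.fracLaplacian_spec v).unique hfrac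
  refine ⟨v, huk, fun k => ?_, ?_, ?_⟩
  -- This explicit multiplier formula is recorded to obtain measurability in t afterwards.
  · rw [hv, hG.sineCoeffL_eq hβ (by linarith), hk, mul_assoc _ (_ ^ 2)]
  · filter_upwards [hu] with x hx'
    exact hx'.trans (hx x).2.tsum_eq
  · rw [HSpace.norm_def, hv]
    exact hn

/-! ### Dependence on time and on the forcing -/

lemma modeConv_eq_exp_mul {s : ℝ} (f : ℝ → HSpace s p) (T t : ℝ) (k : ℕ) :
    modeConv f t k = Real.exp (-((k + 1 : ℕ) : ℝ) ^ 2 * (t - T)) * ∫ r in Ioo 0 t,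
      Real.exp (-((k + 1 : ℕ) : ℝ) ^ 2 * (T - r)) * sineCoeffL k (HSpace.toLp (f r)) := by
  rw [modeConv, ← integral_const_mul]
  congr 1
  ext1 r
  rw [← mul_assoc, ← Real.exp_add]
  congr 2
  ring

/-- Anchoring the exponential at T leaves an integrand that does not depend on t, so the coefficient
is a smooth factor times a primitive of an integrable function. -/
lemma continuousOn_modeConv {s : ℝ} {f : ℝ → HSpace s p} {T : ℝ} {k : ℕ}
    (h : IntegrableOn (fun r => Real.exp (-((k + 1 : ℕ) : ℝ) ^ 2 * (T - r)) *
      sineCoeffL k (HSpace.toLp (f r))) (Ioo 0 T)) :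
    ContinuousOn (fun t => modeConv f t k) (Icc 0 T) := by
  simp only [modeConv_eq_exp_mul f T]
  refine ContinuousOn.mul (by fun_prop) ?_
  simp only [← integral_Ioc_eq_integral_Ioo]
  exact intervalIntegral.continuousOn_primitive (integrableOn_Icc_iff_integrableOn_Ioo enorm_ne_top enorm_ne_top |>.2 h)

section

variable {T γ : ℝ}

lemma ae_restrict_Ioo_of_le {P : ℝ → Prop} {t : ℝ} (htT : t ≤ T)
    (h : ∀ᵐ s ∂(volume.restrict (Ioo 0 T)), P s) : ∀ᵐ s ∂(volume.restrict (Ioo 0 t)), P s :=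
  ae_mono (Measure.restrict_mono (Ioo_subset_Ioo_right htT) le_rfl) h

lemma LinftyH.aestronglyMeasurable_of_le (f : LinftyH T γ p) {t : ℝ} (htT : t ≤ T) :
    AEStronglyMeasurable f (volume.restrict (Ioo 0 t)) :=
  (Lp.aestronglyMeasurable f).mono_measure
    (Measure.restrict_mono (Ioo_subset_Ioo_right htT) le_rfl)

lemma LinftyH.ae_norm_le (f : LinftyH T γ p) {t : ℝ} (htT : t ≤ T) :
    ∀ᵐ s ∂(volume.restrict (Ioo 0 t)), ‖(f : ℝ → HSpace γ p) s‖ ≤ ‖f‖ := by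
  refine ae_restrict_Ioo_of_le htT ?_
  filter_upwards [ae_le_eLpNormEssSup (f := (f : ℝ → HSpace γ p))
    (μ := volume.restrict (Ioo 0 T))] with s hs
  rw [← eLpNorm_exponent_top] at hs
  rw [Lp.norm_def, ← toReal_enorm]
  exact ENNReal.toReal_mono (Lp.eLpNorm_ne_top f) hs

lemma LinftyH.modeConv_spec (hγ0 : 0 < γ) (hγ2 : γ < 2) (f : LinftyH T γ p) {t : ℝ} (ht : 0 < t)
    (htT : t ≤ T) :
    (∀ k, IntegrableOn (fun s => Real.exp (-((k + 1 : ℕ) : ℝ) ^ 2 * (t - s)) *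
      sineCoeffL k (HSpace.toLp ((f : ℝ → HSpace γ p) s))) (Ioo 0 t)) ∧
    (Summable fun k => |modeConv f t k|) ∧ ∀ x,
      IntervalIntegrable (fun s => heatFun (t - s) (HSpace.toLp ((f : ℝ → HSpace γ p) s)) x)
        volume 0 t ∧
      HasSum (fun k => modeConv f t k * sineMode (k + 1) x)
        (∫ s in (0 : ℝ)..t, heatFun (t - s) (HSpace.toLp ((f : ℝ → HSpace γ p) s)) x) :=
  DirichletHeat.modeConv_spec hγ0 hγ2 ht (f.aestronglyMeasurable_of_le htT) (f.ae_norm_le htT)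

lemma LinftyH.modeConv_add (hγ0 : 0 < γ) (hγ2 : γ < 2) (f g : LinftyH T γ p) {t : ℝ}
    (ht : 0 < t) (htT : t ≤ T) (k : ℕ) :
    modeConv (f + g : LinftyH T γ p) t k = modeConv f t k + modeConv g t k := by
  rw [modeConv, modeConv, modeConv, ← integral_add ((f.modeConv_spec hγ0 hγ2 ht htT).1 k)
    ((g.modeConv_spec hγ0 hγ2 ht htT).1 k)]
  refine integral_congr_ae ?_
  filter_upwards [ae_restrict_Ioo_of_le htT (Lp.coeFn_add f g)] with s hs
  rw [hs, Pi.add_apply, map_add, map_add, mul_add]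

lemma LinftyH.modeConv_smul (c : ℝ) (f : LinftyH T γ p) {t : ℝ} (htT : t ≤ T) (k : ℕ) :
    modeConv (c • f : LinftyH T γ p) t k = c * modeConv f t k := by
  rw [modeConv, modeConv, ← integral_const_mul]
  refine integral_congr_ae ?_
  filter_upwards [ae_restrict_Ioo_of_le htT (Lp.coeFn_smul c f)] with s hs
  rw [hs, Pi.smul_apply, map_smul, map_smul, smul_eq_mul]
  ring

end

lemma regBound_nonneg {β γ : ℝ} (hβγ : β < γ) : 0 ≤ regBound β γ := by
  have h1 := fracBound_nonneg β
  have h2 := smoothBound_nonneg (2 - γ)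
  have h3 : 0 < (γ - β) / 2 := by linarith
  unfold regBound
  positivity

end DirichletHeat
end

/-! ### The solution operator -/

theorem mainTheorem1 (β γ : ℝ) (hβ : 0 < β) (hβγ : β < γ) (hγ : γ < 1) :
    ∃ C : ℝ, 0 < C ∧ ∀ (p : ℝ≥0∞) [Fact (1 ≤ p)], p ≠ ∞ → ∀ T : ℝ, 0 < T →
      (∀ f : DirichletHeat.LinftyH T γ p, ∀ t ∈ Ioo 0 T, ∀ x ∈ Ioo 0 Real.pi,
        IntervalIntegrable (fun s => ∫ y in (0 : ℝ)..Real.pi,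
          DirichletHeat.heatKernel (t - s) x y * f.toFun s y) volume 0 t) ∧
      ∃ L : DirichletHeat.LinftyH T γ p →L[ℝ] DirichletHeat.LinftyH T (2 + β) p,
        (∀ f : DirichletHeat.LinftyH T γ p, ∀ᵐ t ∂(volume.restrict (Ioo 0 T)),
          ∀ᵐ x ∂(volume.restrict (Ioo 0 Real.pi)),
            (L f).toFun t x = DirichletHeat.heatConv f.toFun t x) ∧
        ∀ f : DirichletHeat.LinftyH T γ p, ‖L f‖ ≤ C * T ^ ((γ - β) / 2) * ‖f‖ := by
  have hγ0 : 0 < γ := hβ.trans hβγ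
  have hγ2 : γ < 2 := by linarith
  have hR := DirichletHeat.regBound_nonneg hβγ
  -- `regBound` is only known to be nonnegative; adding 1 makes the constant positive.
  refine ⟨DirichletHeat.regBound β γ + 1, by linarith, fun p _ hp' T hT => ⟨fun f t ht x _ =>
    ((f.modeConv_spec hγ0 hγ2 ht.1 ht.2.le).2.2 x).1, ?_⟩⟩
  set K := (DirichletHeat.regBound β γ + 1) * T ^ ((γ - β) / 2) with hK
  have hK0 : 0 ≤ K := by positivity
  have hS : ∀ (f : DirichletHeat.LinftyH T γ p) (t : ℝ), ∃ v : DirichletHeat.HSpace (2 + β) p,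
      t ∈ Ioo 0 T → (∀ k, DirichletHeat.sineCoeffL k (DirichletHeat.HSpace.toLp v) =
        DirichletHeat.modeConv f t k) ∧
      (∀ k, DirichletHeat.sineCoeffL k (DirichletHeat.HSpace.fracLaplacian v) =
        DirichletHeat.fracConst β * ((k + 1 : ℕ) : ℝ) ^ β * ((k + 1 : ℕ) : ℝ) ^ 2 *
          DirichletHeat.modeConv f t k) ∧
      (∀ᵐ x ∂DirichletHeat.intervalMeasure, (DirichletHeat.HSpace.toLp v : ℝ → ℝ) x =
        DirichletHeat.heatConv f.toFun t x) ∧ ‖v‖ ≤ K * ‖f‖ := fun f t => by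
    by_cases ht : t ∈ Ioo 0 T
    · obtain ⟨v, h1, h2, h3, h4⟩ := DirichletHeat.exists_solution hp' hβ hβγ hγ ht.1
        (f.aestronglyMeasurable_of_le ht.2.le) (f.ae_norm_le ht.2.le)
      refine ⟨v, fun _ => ⟨h1, h2, h3, h4.trans ?_⟩⟩
      have : t ^ ((γ - β) / 2) ≤ T ^ ((γ - β) / 2) :=
        Real.rpow_le_rpow ht.1.le ht.2.le (by linarith)
      have h0 : 0 ≤ t ^ ((γ - β) / 2) := Real.rpow_nonneg ht.1.le _
      rw [hK]
      gcongr
      linarith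
    · exact ⟨0, fun h => absurd h ht⟩
  choose S hS using hS
  set μ : Measure ℝ := volume.restrict (Ioo 0 T) with hμ
  have hmem : ∀ᵐ t ∂μ, t ∈ Ioo 0 T := ae_restrict_mem measurableSet_Ioo
  have hbound : ∀ f, ∀ᵐ t ∂μ, ‖S f t‖ ≤ K * ‖f‖ := fun f =>
    hmem.mono fun t ht => (hS f t ht).2.2.2
  have hmeas : ∀ f, AEStronglyMeasurable (S f) μ := fun f => by
    -- The solutions were chosen separately for each t. The isometric embedding into L_p reduces
    -- measurability to the coefficients, which are continuous in t on (0, T).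
    rw [← DirichletHeat.HSpace.isometry_fracLaplacian.isEmbedding.aestronglyMeasurable_comp_iff]
    refine DirichletHeat.aestronglyMeasurable_of_sineCoeffL hp' fun k => ?_
    have hc : ContinuousOn (fun t => DirichletHeat.modeConv f t k) (Ioo 0 T) :=
      (DirichletHeat.continuousOn_modeConv
        ((f.modeConv_spec hγ0 hγ2 hT le_rfl).1 k)).mono Ioo_subset_Icc_self
    exact ((hc.aemeasurable measurableSet_Ioo).const_mul _).congr
      (hmem.mono fun t ht => ((hS f t ht).2.1 k).symm)
  have hLp : ∀ f, MemLp (S f) ∞ μ := fun f => memLp_top_of_bound (hmeas f) _ (hbound f)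
  have hcoe : ∀ f, (hLp f).toLp =ᵐ[μ] S f := fun f => (hLp f).coeFn_toLp
  have hnorm : ∀ f, ‖(hLp f).toLp‖ ≤ K * ‖f‖ := fun f => by
    have h := Lp.norm_le_of_ae_bound (f := (hLp f).toLp) (C := K * ‖f‖) (by positivity) (by
      filter_upwards [hcoe f, hbound f] with t h1 h2
      rwa [h1])
    simpa using h
  refine ⟨LinearMap.mkContinuous ⟨⟨fun f => (hLp f).toLp, fun f g => ?_⟩, fun c f => ?_⟩ K hnorm,
    fun f => ?_, hnorm⟩
  · refine Lp.ext ?_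
    filter_upwards [hmem, hcoe (f + g), hcoe f, hcoe g,
      Lp.coeFn_add (hLp f).toLp (hLp g).toLp] with t ht h1 h2 h3 h4
    rw [h1, h4, Pi.add_apply, h2, h3]
    -- The chosen solutions are determined by their coefficients, and these are linear in the
    -- forcing.
    refine DirichletHeat.HSpace.eq_of_sineCoeffL_eq fun k => ?_
    rw [map_add, map_add, (hS _ t ht).1, (hS f t ht).1, (hS g t ht).1,
      DirichletHeat.LinftyH.modeConv_add hγ0 hγ2 f g ht.1 ht.2.le]
  · refine Lp.ext ?_
    filter_upwards [hmem, hcoe (c • f), hcoe f, Lp.coeFn_smul c (hLp f).toLp] with t ht h1 h2 h4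
    simp only [RingHom.id_apply]
    rw [h1, h4, Pi.smul_apply, h2]
    refine DirichletHeat.HSpace.eq_of_sineCoeffL_eq fun k => ?_
    rw [map_smul, map_smul, (hS _ t ht).1, (hS f t ht).1,
      DirichletHeat.LinftyH.modeConv_smul c f ht.2.le, smul_eq_mul]
  · filter_upwards [hmem, hcoe f] with t ht h1
    filter_upwards [(hS f t ht).2.2.1] with x hx
    rw [← hx, ← h1]
    rfl
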